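/- Let $\mathbb T$ be the unit circle with normalized Lebesgue measure $m$, and let $H^2\subset L^2(\mathbb T)=L^2(m)$ be the Hardy space, i.e. the functions whose Fourier coefficients of negative index vanish. Let $\Lambda=(\lambda_j)_{j\ge 0}$ be an arbitrary sequence in the open unit disk $\mathbb D$. For $N\ge 1$ let $$B_N(z)=\prod_{j=0}^{N-1}\frac{\overline{\lambda_j}}{|\lambda_j|}\,\frac{z-\lambda_j}{1-\overline{\lambda_j}\,z}\qquad\bigl(\text{with } \overline{\lambda_j}/|\lambda_j|:=1 \text{ if } \lambda_j=0\bigr)$$ be the Blaschke product with zeros $\lambda_0,\dots,\lambda_{N-1}$, let $K_{B_N}=H^2\ominus B_NH^2$ be the associated ($N$-dimensional) model space, and for $\varphi\in L^\infty(\mathbb T)$ let $T_{B_N}(\varphi)$ be the truncated Toeplitz operator on $K_{B_N}$, $T_{B_N}(\varphi)u=P_{K_{B_N}}(\varphi u)$, where $P_{K_{B_N}}$ is the orthogonal projection of $L^2(\mathbb T)$ onto $K_{B_N}$. Let $$d\nu_N(\zeta)=\frac1N\sum_{j=0}^{N-1}\frac{1-|\lambda_j|^2}{|\zeta-\lambda_j|^2}\,dm(\zeta)$$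 be the mean of the harmonic measures on $\mathbb T$ at $\lambda_0,\dots,\lambda_{N-1}$, and let $\mathcal X_\Lambda$ be the closure of $C(\mathbb T)$ in the norm $\|f\|_\Lambda=\sup_{N\ge1}\|f\|_{L^2(\nu_N)}$. Let $\varphi\in L^\infty(\mathbb T)\cap\mathcal X_\Lambda$ and let $f$ be analytic on a neighbourhood of the closed convex hull of the essential range of $\varphi$. Then $$\lim_{N\to\infty}\left|\frac1N\operatorname{Tr} f\bigl(T_{B_N}(\varphi)\bigr)-\int_{\mathbb T} f(\varphi(\zeta))\,d\nu_N(\zeta)\right|=0,$$ where $f(T_{B_N}(\varphi))$ is defined by the holomorphic (Riesz--Dunford) functional calculus. Moreover, if $\varphi$ is real-valued, the same limit relation holds for every complex-valued $f$ that is continuous on $[\operatorname{ess\,inf}\varphi,\operatorname{ess\,sup}\varphi]$, where now $f(T_{B_N}(\varphi))$ is defined by the continuous functional calculus of the self-adjoint operator $T_{B_N}(\varphi)$. -/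

import Mathlib

open MeasureTheory Filter Topology
open scoped ENNReal ComplexConjugate

noncomputable section

namespace SzegoTTO

/-- The unit circle `𝕋`, parametrised by `t ∈ ℝ/ℤ` through `ζ = exp(2πit)`. -/
abbrev 𝕋 : Type := UnitAddCircle

/-- Normalised Lebesgue measure on `𝕋`. -/
abbrev m : Measure 𝕋 := AddCircle.haarAddCircle

/-- The point `ζ = exp(2πit)` of the unit circle in `ℂ` with parameter `t`. -/
def pt (t : 𝕋) : ℂ := (AddCircle.toCircle t : ℂ)

/-- The Hilbert space `L²(𝕋)`. -/
abbrev L2 : Type := Lp ℂ 2 m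

/-- The space `L^∞(𝕋)`. -/
abbrev Linf : Type := Lp ℂ ∞ m

/-- The Hardy space `H²` as a subspace of `L²(𝕋)`: the functions all of whose Fourier
coefficients with negative index vanish. -/
def hardy : Submodule ℂ L2 where
  carrier := {f | ∀ n : ℤ, n < 0 → fourierCoeff (f : 𝕋 → ℂ) n = 0}
  zero_mem' := by
    intro n _
    rw [← fourierBasis_repr]
    simp
  add_mem' := by
    intro f g hf hg n hn
    have h1 := hf n hn
    have h2 := hg n hn
    rw [← fourierBasis_repr] at h1 h2 ⊢
    simp [h1, h2]
  smul_mem' := by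
    intro c f hf n hn
    have h1 := hf n hn
    rw [← fourierBasis_repr] at h1 ⊢
    simp [h1]

lemma isClosed_hardy : IsClosed (hardy : Set L2) := by
  have h : (hardy : Set L2) =
      ⋂ n : ℤ, ⋂ _ : n < 0, {f : L2 | inner ℂ (fourierBasis (T := 1) n) f = 0} := by
    ext f
    simp only [Set.mem_iInter, Set.mem_ofPred_eq]
    refine forall_congr' fun n => forall_congr' fun _ => ?_
    rw [← HilbertBasis.repr_apply_apply, fourierBasis_repr]
  rw [h]
  refine isClosed_iInter fun n => isClosed_iInter fun _ => ?_
  exact isClosed_eq (by fun_prop) continuous_const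

/-- The subspace `B H² = {B g : g ∈ H²}` of `L²(𝕋)`, for a function `B` on the circle. -/
def mulHardy (B : 𝕋 → ℂ) : Submodule ℂ L2 where
  carrier := {h | ∃ g ∈ hardy, (h : 𝕋 → ℂ) =ᵐ[m] fun t => B t * (g : 𝕋 → ℂ) t}
  zero_mem' := by
    refine ⟨0, hardy.zero_mem, ?_⟩
    filter_upwards [Lp.coeFn_zero ℂ 2 m] with t ht
    rw [ht]
    simp
  add_mem' := by
    rintro h₁ h₂ ⟨g₁, hg₁, e₁⟩ ⟨g₂, hg₂, e₂⟩
    refine ⟨g₁ + g₂, hardy.add_mem hg₁ hg₂, ?_⟩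
    filter_upwards [e₁, e₂, Lp.coeFn_add h₁ h₂, Lp.coeFn_add g₁ g₂] with t a b c d
    rw [c, d, Pi.add_apply, Pi.add_apply, a, b, mul_add]
  smul_mem' := by
    rintro c h ⟨g, hg, e⟩
    refine ⟨c • g, hardy.smul_mem c hg, ?_⟩
    filter_upwards [e, Lp.coeFn_smul c h, Lp.coeFn_smul c g] with t a b d
    simp [a, b, d, mul_left_comm]

/-- The model space `K_B = H² ⊖ B H²`. -/
def modelSpace (B : 𝕋 → ℂ) : Submodule ℂ L2 := hardy ⊓ (mulHardy B)ᗮ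

instance (B : 𝕋 → ℂ) : CompleteSpace (modelSpace B) :=
  (isClosed_hardy.inter (mulHardy B).isClosed_orthogonal).completeSpace_coe

/-- Multiplication by `φ ∈ L^∞(𝕋)` on `L²(𝕋)`. -/
def mulOp (φ : Linf) : L2 →L[ℂ] L2 := (ContinuousLinearMap.mul ℂ ℂ).holderL m ∞ 2 2 φ

/-- The truncated Toeplitz operator `T_B(φ)`: the compression to `K_B` of multiplication
by `φ`, that is `u ↦ P_{K_B}(φ u)`. -/
def truncToeplitz (B : 𝕋 → ℂ) (φ : Linf) : modelSpace B →L[ℂ] modelSpace B :=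
  (modelSpace B).orthogonalProjectionOnto ∘L mulOp φ ∘L (modelSpace B).subtypeL

/-- The Blaschke product `B_N` with zeros `Λ 0, …, Λ (N - 1)`. -/
def blaschke (Λ : ℕ → ℂ) (N : ℕ) (z : ℂ) : ℂ :=
  ∏ j ∈ Finset.range N,
    (if Λ j = 0 then 1 else conj (Λ j) / (‖Λ j‖ : ℂ)) * ((z - Λ j) / (1 - conj (Λ j) * z))

/-- The operator `T_{B_N}(φ)` on `K_{B_N}`. -/
abbrev toeplitzN (Λ : ℕ → ℂ) (N : ℕ) (φ : Linf) :
    modelSpace (fun t => blaschke Λ N (pt t)) →L[ℂ] modelSpace (fun t => blaschke Λ N (pt t)) :=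
  truncToeplitz (fun t => blaschke Λ N (pt t)) φ

/-- The mean `ν_N` of the harmonic measures on `𝕋` at `Λ 0, …, Λ (N - 1)`. -/
def nu (Λ : ℕ → ℂ) (N : ℕ) : Measure 𝕋 :=
  m.withDensity fun t => ENNReal.ofReal
    ((1 / (N : ℝ)) * ∑ j ∈ Finset.range N, (1 - ‖Λ j‖ ^ 2) / ‖pt t - Λ j‖ ^ 2)

/-- The norm `‖f‖_Λ = sup_{N ≥ 1} ‖f‖_{L²(ν_N)}` (possibly infinite). -/
def normΛ (Λ : ℕ → ℂ) (f : 𝕋 → ℂ) : ℝ≥0∞ := ⨆ N : ℕ, ⨆ _ : 1 ≤ N, eLpNorm f 2 (nu Λ N)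

/-- The space `𝒳_Λ`: the closure of `C(𝕋)` in the norm `‖·‖_Λ`. -/
def spaceX (Λ : ℕ → ℂ) : Set (𝕋 → ℂ) :=
  {f | AEStronglyMeasurable f m ∧
    ∀ ε : ℝ≥0∞, 0 < ε → ∃ g : C(𝕋, ℂ), normΛ Λ (fun t => f t - g t) < ε}

/-- The essential range of a function on `𝕋`. -/
def essRange (φ : 𝕋 → ℂ) : Set ℂ := {w | ∀ ε : ℝ, 0 < ε → 0 < m {t | ‖φ t - w‖ < ε}}

/-- The Riesz–Dunford functional calculus `f(T) = (2πi)⁻¹ ∫_Γ f(z) (z - T)⁻¹ dz` for an element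
`T` with finite spectrum. The contour `Γ` consists of the circles of radius `r` around the points
of the spectrum; for `f` holomorphic near the spectrum the integral does not depend on `r` once
`r > 0` is small, and the limit as `r → 0` is this common value. -/
def holFC {A : Type*} [NormedRing A] [NormedAlgebra ℂ A] (f : ℂ → ℂ) (T : A) : A :=
  letI : Nonempty A := ⟨0⟩
  limUnder (𝓝[>] (0 : ℝ)) fun r : ℝ =>
    (2 * (Real.pi : ℂ) * Complex.I)⁻¹ •
      ∑ᶠ μ ∈ spectrum ℂ T, ∮ z in C(μ, r), f z • resolvent T z

/-- The operator `f(T)` given by the continuous functional calculus, for a self-adjoint operator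
`T` on a Hilbert space and a complex-valued function `f` on the real line. -/
def contFC {E : Type*} [NormedAddCommGroup E] [InnerProductSpace ℂ E] [CompleteSpace E]
    (f : ℝ → ℂ) (T : E →L[ℂ] E) : E →L[ℂ] E :=
  cfc (p := IsStarNormal) (fun z : ℂ => f z.re) T

/-- The trace of a bounded operator on a (finite-dimensional) space. -/
def tr {E : Type*} [NormedAddCommGroup E] [NormedSpace ℂ E] (S : E →L[ℂ] E) : ℂ :=
  LinearMap.trace ℂ E (S : E →ₗ[ℂ] E)

end SzegoTTO

end

/-! Let `P` be the projection onto the model space `K_N`, and `M_ψ` multiplication by `ψ`. The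
off-diagonal part `(1 - P) A P` measures how far `A` is from leaving `K_N` invariant. Since `P A B P
- P A P · P B P = P A (1 - P) B P`, compression is asymptotically multiplicative on operators whose
off-diagonal parts are `o(√N)` in Hilbert–Schmidt norm. These operators form an algebra,
`almostInvariant`. For `A` in it and a polynomial `p`, the operators `P p(A) P` and `p(P A P)`
differ by `o(√N)`, hence by Cauchy–Schwarz their traces differ by `o(N)`.

Multiplication by `ζ` and by its conjugate has off-diagonal part of rank at most one, so the algebra
contains the trigonometric polynomials and, by density, all of `C(𝕋)`. The Takenaka–Malmquist basis
satisfies `∑ |e_k|² = N dν_N/dm`. Integrating against this density gives the exact formulas `Tr (P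
M_ψ P) = N ∫ ψ dν_N` (`tr_compress_eq`) and `‖M_ψ P‖²_HS = N ‖ψ‖²_{L²(ν_N)}` (`enorm_hsNorm_mulOp`).
The second carries membership in the algebra from `C(𝕋)` to bounded functions in `𝒳_Λ`; the first
then yields the theorem for polynomials (`tendsto_tr_aeval_toeplitzN`).

For general `f`, the spectrum lies in the numerical range, hence in the closed convex hull of the
essential range, where polynomials approximate `f` uniformly (Runge, or Weierstrass for real `φ`).
The operator need not be normal, so `f(T) - p(T)` is not estimated in norm in the holomorphic case.
Instead `Tr f(T)` is the sum of `f` over the eigenvalues with algebraic multiplicity (`tr_holFC`),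
and the multiplicities add up to `N`. -/

noncomputable section

namespace SzegoTTO

/-! ### Hilbert–Schmidt norms and traces. -/

section HilbertSchmidt

variable {ι : Type*} [Fintype ι]
variable {E F G : Type*} [NormedAddCommGroup E] [InnerProductSpace ℂ E]
  [NormedAddCommGroup F] [InnerProductSpace ℂ F] [NormedAddCommGroup G] [InnerProductSpace ℂ G]

/-- The Hilbert–Schmidt norm of an operator, computed in the orthonormal basis `b`. -/
def hsNorm (b : OrthonormalBasis ι ℂ E) (A : E →L[ℂ] F) : ℝ :=
  ‖(WithLp.toLp 2 fun i => A (b i) : PiLp 2 fun _ : ι => F)‖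

lemma hsNorm_nonneg (b : OrthonormalBasis ι ℂ E) (A : E →L[ℂ] F) : 0 ≤ hsNorm b A :=
  norm_nonneg _

lemma hsNorm_sq (b : OrthonormalBasis ι ℂ E) (A : E →L[ℂ] F) :
    hsNorm b A ^ 2 = ∑ i, ‖A (b i)‖ ^ 2 := by
  rw [hsNorm, PiLp.norm_sq_eq_of_L2]

lemma hsNorm_add_le (b : OrthonormalBasis ι ℂ E) (A A' : E →L[ℂ] F) :
    hsNorm b (A + A') ≤ hsNorm b A + hsNorm b A' :=
  norm_add_le (WithLp.toLp 2 fun i => A (b i) : PiLp 2 fun _ : ι => F)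
    (WithLp.toLp 2 fun i => A' (b i))

lemma hsNorm_smul (b : OrthonormalBasis ι ℂ E) (c : ℂ) (A : E →L[ℂ] F) :
    hsNorm b (c • A) = ‖c‖ * hsNorm b A :=
  norm_smul c (WithLp.toLp 2 fun i => A (b i) : PiLp 2 fun _ : ι => F)

@[simp]
lemma hsNorm_zero (b : OrthonormalBasis ι ℂ E) : hsNorm b (0 : E →L[ℂ] F) = 0 := by
  simpa using hsNorm_smul b 0 (0 : E →L[ℂ] F)

lemma hsNorm_comp_le (b : OrthonormalBasis ι ℂ E) (C : F →L[ℂ] G) (A : E →L[ℂ] F) :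
    hsNorm b (C ∘L A) ≤ ‖C‖ * hsNorm b A := by
  refine le_of_sq_le_sq ?_ (by positivity [hsNorm_nonneg b A])
  rw [mul_pow, hsNorm_sq, hsNorm_sq, Finset.mul_sum]
  refine Finset.sum_le_sum fun i _ => ?_
  rw [← mul_pow]
  exact pow_le_pow_left₀ (norm_nonneg _) (C.le_opNorm _) 2

/-- The Hilbert–Schmidt norm of an operator and of its adjoint agree. -/
lemma hsNorm_sq_eq_sum_adjoint [CompleteSpace E] [CompleteSpace F] {κ : Type*} [Fintype κ]
    (b : OrthonormalBasis ι ℂ E) (A : E →L[ℂ] F) {R : Submodule ℂ F}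
    (c : OrthonormalBasis κ ℂ R) (hA : ∀ x, A x ∈ R) :
    hsNorm b A ^ 2 = ∑ j, ‖A.adjoint (c j : F)‖ ^ 2 := by
  have h1 (i : ι) : ‖A (b i)‖ ^ 2 = ∑ j, ‖inner ℂ (A.adjoint (c j : F)) (b i)‖ ^ 2 := by
    have := c.sum_sq_norm_inner_right ⟨A (b i), hA _⟩
    simp only [Submodule.coe_norm, Submodule.coe_inner] at this
    rw [← this]
    simp [ContinuousLinearMap.adjoint_inner_left]
  rw [hsNorm_sq, Finset.sum_congr rfl fun i _ => h1 i, Finset.sum_comm]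
  refine Finset.sum_congr rfl fun j _ => ?_
  exact b.sum_sq_norm_inner_left _

/-- Taking adjoints turns the right factor into a left one, where the estimate is pointwise. The
range of `A` is finite-dimensional and supplies the second orthonormal basis. -/
lemma hsNorm_comp_le_mul [CompleteSpace E] [CompleteSpace F] [FiniteDimensional ℂ E]
    (b : OrthonormalBasis ι ℂ E) (A : E →L[ℂ] F) (C : E →L[ℂ] E) :
    hsNorm b (A ∘L C) ≤ hsNorm b A * ‖C‖ := by
  let R : Submodule ℂ F := LinearMap.range (A : E →ₗ[ℂ] F)
  let c := stdOrthonormalBasis ℂ R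
  have hA (x : E) : A x ∈ R := ⟨x, rfl⟩
  refine le_of_sq_le_sq ?_ (by positivity [hsNorm_nonneg b A])
  rw [mul_pow, hsNorm_sq_eq_sum_adjoint b A c hA,
    hsNorm_sq_eq_sum_adjoint b (A ∘L C) c fun x => hA _, Finset.sum_mul]
  refine Finset.sum_le_sum fun i _ => ?_
  rw [ContinuousLinearMap.adjoint_comp, ← mul_pow, mul_comm]
  refine pow_le_pow_left₀ (norm_nonneg _) ((C.adjoint.le_opNorm _).trans_eq ?_) 2
  rw [LinearIsometryEquiv.norm_map]
  rfl

lemma tr_eq_sum_inner (b : OrthonormalBasis ι ℂ E) (A : E →L[ℂ] E) :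
    tr A = ∑ i, inner ℂ (b i) (A (b i)) :=
  LinearMap.trace_eq_sum_inner (A : E →ₗ[ℂ] E) b

/-- Cauchy–Schwarz. On an `N`-dimensional space the factor is `√N`, which is why errors of size
`o(√N)` are harmless after dividing the trace by `N`. -/
lemma norm_tr_le_hsNorm (b : OrthonormalBasis ι ℂ E) (A : E →L[ℂ] E) :
    ‖tr A‖ ≤ √(Fintype.card ι) * hsNorm b A := by
  have h1 : ‖tr A‖ ≤ ∑ i, ‖A (b i)‖ := by
    rw [tr_eq_sum_inner b]
    refine (norm_sum_le _ _).trans (Finset.sum_le_sum fun i _ => ?_)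
    simpa using norm_inner_le_norm (𝕜 := ℂ) (b i) (A (b i))
  refine h1.trans (le_of_sq_le_sq ?_ (by positivity [hsNorm_nonneg b A]))
  rw [mul_pow, Real.sq_sqrt (by positivity), hsNorm_sq]
  exact sq_sum_le_card_mul_sum_sq

lemma norm_tr_le_opNorm (b : OrthonormalBasis ι ℂ E) (A : E →L[ℂ] E) :
    ‖tr A‖ ≤ Fintype.card ι * ‖A‖ := by
  rw [tr_eq_sum_inner b]
  refine (norm_sum_le _ _).trans ?_
  rw [← nsmul_eq_mul, Fintype.card, ← Finset.sum_const]
  refine Finset.sum_le_sum fun i _ => (norm_inner_le_norm (𝕜 := ℂ) _ _).trans ?_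
  simpa using A.le_opNorm (b i)

end HilbertSchmidt

/-! ### Compressions and their failure to be multiplicative. -/

section Compression

variable {H : Type*} [NormedAddCommGroup H] [InnerProductSpace ℂ H]

/-- The compression of an operator to a subspace. -/
def compress (K : Submodule ℂ H) [K.HasOrthogonalProjection] (A : H →L[ℂ] H) : K →L[ℂ] K :=
  K.orthogonalProjectionOnto ∘L A ∘L K.subtypeL

/-- The part of an operator that maps a subspace into its orthogonal complement. -/
def offDiag (K : Submodule ℂ H) [K.HasOrthogonalProjection] (A : H →L[ℂ] H) : K →L[ℂ] H :=
  Kᗮ.starProjection ∘L A ∘L K.subtypeL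

variable (K : Submodule ℂ H) [K.HasOrthogonalProjection]

lemma offDiag_apply (A : H →L[ℂ] H) (x : K) :
    offDiag K A x = A x - K.starProjection (A x) := by
  simp [offDiag, Submodule.starProjection_orthogonal_val]

lemma compress_add (A B : H →L[ℂ] H) : compress K (A + B) = compress K A + compress K B := by
  ext; simp [compress]

lemma compress_smul (c : ℂ) (A : H →L[ℂ] H) : compress K (c • A) = c • compress K A := by
  ext; simp [compress]

lemma compress_one : compress K 1 = 1 := by
  ext; simp [compress]

lemma offDiag_add (A B : H →L[ℂ] H) : offDiag K (A + B) = offDiag K A + offDiag K B := by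
  ext; simp [offDiag]

lemma offDiag_smul (c : ℂ) (A : H →L[ℂ] H) : offDiag K (c • A) = c • offDiag K A := by
  ext; simp [offDiag]

lemma offDiag_one : offDiag K 1 = 0 := by
  ext x; simp [offDiag_apply]

lemma norm_compress_le (A : H →L[ℂ] H) : ‖compress K A‖ ≤ ‖A‖ := by
  refine ContinuousLinearMap.opNorm_le_bound _ (norm_nonneg _) fun x => ?_
  exact (K.norm_orthogonalProjectionOnto_apply_le _).trans (A.le_opNorm _)

/-- Inserting `P + (1 - P)` between the factors leaves a defect that involves only the off-diagonal
part of the right factor. -/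
lemma compress_mul (A B : H →L[ℂ] H) :
    compress K (A * B) = compress K A * compress K B +
      (K.orthogonalProjectionOnto ∘L A) ∘L offDiag K B := by
  ext x
  simp [compress, offDiag_apply]

/-- A Leibniz rule, again from inserting `P + (1 - P)`: it makes the almost invariant operators
closed under products. -/
lemma offDiag_mul (A B : H →L[ℂ] H) :
    offDiag K (A * B) = (Kᗮ.starProjection ∘L A) ∘L offDiag K B +
      offDiag K A ∘L compress K B := by
  ext x
  simp only [offDiag, compress, ContinuousLinearMap.coe_comp, ContinuousLinearMap.mul_def,
    add_apply, Function.comp_apply, Submodule.subtypeL_apply,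
    Submodule.starProjection_orthogonal_val (K := K) (B _), map_sub]
  simp

variable {ι : Type*} [Fintype ι] (b : OrthonormalBasis ι ℂ K)

lemma hsNorm_compress_mul_sub_le (A B : H →L[ℂ] H) :
    hsNorm b (compress K (A * B) - compress K A * compress K B) ≤
      ‖A‖ * hsNorm b (offDiag K B) := by
  rw [compress_mul, add_sub_cancel_left]
  refine (hsNorm_comp_le b _ _).trans (mul_le_mul_of_nonneg_right ?_ (hsNorm_nonneg _ _))
  refine (ContinuousLinearMap.opNorm_comp_le _ _).trans ?_
  exact mul_le_of_le_one_left (norm_nonneg _) K.orthogonalProjectionOnto_norm_le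

lemma hsNorm_offDiag_le (A : H →L[ℂ] H) : hsNorm b (offDiag K A) ≤ hsNorm b (A ∘L K.subtypeL) :=
  (hsNorm_comp_le b _ _).trans
    (mul_le_of_le_one_left (hsNorm_nonneg _ _) Kᗮ.starProjection_norm_le)

lemma hsNorm_offDiag_mul_le [CompleteSpace H] [FiniteDimensional ℂ K] (A B : H →L[ℂ] H) :
    hsNorm b (offDiag K (A * B)) ≤
      ‖A‖ * hsNorm b (offDiag K B) + hsNorm b (offDiag K A) * ‖B‖ := by
  rw [offDiag_mul]
  refine (hsNorm_add_le b _ _).trans (add_le_add ?_ ?_)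
  · refine (hsNorm_comp_le b _ _).trans (mul_le_mul_of_nonneg_right ?_ (hsNorm_nonneg _ _))
    refine (ContinuousLinearMap.opNorm_comp_le _ _).trans ?_
    exact mul_le_of_le_one_left (norm_nonneg _) Kᗮ.starProjection_norm_le
  · exact (hsNorm_comp_le_mul b _ _).trans
      (mul_le_mul_of_nonneg_left (norm_compress_le K B) (hsNorm_nonneg _ _))

end Compression

/-! ### The algebra of almost invariant operators. -/

section AlmostInvariant

variable {H : Type*} [NormedAddCommGroup H] [InnerProductSpace ℂ H] [CompleteSpace H]
variable {K : ℕ → Submodule ℂ H} [∀ N, (K N).HasOrthogonalProjection]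

/-- The operators that leave the `N`-dimensional subspaces `K N` invariant up to an error which is
`o(√N)` in the Hilbert–Schmidt norm. -/
def almostInvariant (b : ∀ N, OrthonormalBasis (Fin N) ℂ (K N)) : Subalgebra ℂ (H →L[ℂ] H) where
  carrier := {A | Tendsto (fun N : ℕ => hsNorm (b N) (offDiag (K N) A) / √N) atTop (𝓝 0)}
  mul_mem' := by
    intro A B hA hB
    have h := (hB.const_mul ‖A‖).add (hA.mul_const ‖B‖)
    simp only [mul_zero, zero_mul, add_zero] at h
    refine squeeze_zero (fun N => div_nonneg (hsNorm_nonneg _ _) (by positivity)) (fun N => ?_) h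
    have : FiniteDimensional ℂ (K N) := (b N).toBasis.finiteDimensional_of_finite
    rw [← mul_div_assoc, div_mul_eq_mul_div, ← add_div]
    gcongr
    exact hsNorm_offDiag_mul_le (K N) (b N) A B
  add_mem' := by
    intro A B hA hB
    have h := hA.add hB
    simp only [add_zero] at h
    refine squeeze_zero (fun N => div_nonneg (hsNorm_nonneg _ _) (by positivity)) (fun N => ?_) h
    rw [← add_div, offDiag_add]
    gcongr
    exact hsNorm_add_le _ _ _
  algebraMap_mem' := by
    intro c
    simp [Algebra.algebraMap_eq_smul_one, offDiag_smul, offDiag_one]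

lemma mem_almostInvariant {b : ∀ N, OrthonormalBasis (Fin N) ℂ (K N)} {A : H →L[ℂ] H} :
    A ∈ almostInvariant b ↔
      Tendsto (fun N : ℕ => hsNorm (b N) (offDiag (K N) A) / √N) atTop (𝓝 0) :=
  Iff.rfl

lemma mem_almostInvariant_of_bounded {b : ∀ N, OrthonormalBasis (Fin N) ℂ (K N)}
    {A : H →L[ℂ] H} (C : ℝ) (hC : ∀ N, hsNorm (b N) (offDiag (K N) A) ≤ C) :
    A ∈ almostInvariant b := by
  have h : Tendsto (fun N : ℕ => C / √(N : ℝ)) atTop (𝓝 0) :=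
    tendsto_const_nhds.div_atTop (Real.tendsto_sqrt_atTop.comp tendsto_natCast_atTop_atTop)
  refine squeeze_zero (fun N => div_nonneg (hsNorm_nonneg _ _) (by positivity)) (fun N => ?_) h
  gcongr
  exact hC N

/-- The closeness required is in Hilbert–Schmidt norm on `K N` only, for `N ≥ 1`. This is weaker
than operator norm, and it is what approximation in `‖·‖_Λ` provides. -/
lemma mem_almostInvariant_of_approx {b : ∀ N, OrthonormalBasis (Fin N) ℂ (K N)}
    {A : H →L[ℂ] H}
    (hA : ∀ ε : ℝ, 0 < ε → ∃ B ∈ almostInvariant b, ∀ N : ℕ, 1 ≤ N →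
      hsNorm (b N) ((A - B) ∘L (K N).subtypeL) ≤ ε * √N) :
    A ∈ almostInvariant b := by
  rw [mem_almostInvariant, Metric.tendsto_atTop]
  intro ε hε
  obtain ⟨B, hB, h⟩ := hA (ε / 2) (by positivity)
  obtain ⟨n, hn⟩ := Metric.tendsto_atTop.1 (mem_almostInvariant.1 hB) (ε / 2) (by positivity)
  refine ⟨max n 1, fun N hN => ?_⟩
  have hN1 : 1 ≤ N := (le_max_right _ _).trans hN
  have h0 : 0 < √(N : ℝ) := Real.sqrt_pos.2 (by exact_mod_cast hN1)
  have h1 := hn N ((le_max_left _ _).trans hN)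
  rw [Real.dist_eq, sub_zero, abs_of_nonneg
    (div_nonneg (hsNorm_nonneg _ _) (Real.sqrt_nonneg _))] at h1 ⊢
  rw [div_lt_iff₀ h0] at h1 ⊢
  have h2 : offDiag (K N) A = offDiag (K N) (A - B) + offDiag (K N) B := by
    rw [← offDiag_add, sub_add_cancel]
  have h3 := hsNorm_add_le (b N) (offDiag (K N) (A - B)) (offDiag (K N) B)
  have h4 := (hsNorm_offDiag_le (K N) (b N) (A - B)).trans (h N hN1)
  rw [h2]
  linarith

/-- The compression of an almost invariant operator is asymptotically multiplicative. -/
lemma tendsto_hsNorm_compress_aeval_sub {b : ∀ N, OrthonormalBasis (Fin N) ℂ (K N)}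
    {A : H →L[ℂ] H} (hA : A ∈ almostInvariant b) (p : Polynomial ℂ) :
    Tendsto (fun N : ℕ => hsNorm (b N) (compress (K N) (Polynomial.aeval A p) -
      Polynomial.aeval (compress (K N) A) p) / √N) atTop (𝓝 0) := by
  induction p using Polynomial.induction_on with
  | C a => simp [Algebra.algebraMap_eq_smul_one, compress_smul, compress_one]
  | add p q hp hq =>
    have h := hp.add hq
    simp only [add_zero] at h
    refine squeeze_zero (fun N => div_nonneg (hsNorm_nonneg _ _) (by positivity)) (fun N => ?_) h
    rw [← add_div, map_add, map_add, compress_add, add_sub_add_comm]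
    gcongr
    exact hsNorm_add_le _ _ _
  | monomial n a ih =>
    set q : Polynomial ℂ := .C a * .X ^ n
    -- With `X` on the left, the multiplicativity defect involves the off-diagonal part of `q(A)`,
    -- which is small because `q(A)` stays in the algebra. The other error is the inductive one,
    -- multiplied by the compression of `A`.
    have hq : (.C a * .X ^ (n + 1) : Polynomial ℂ) = .X * q := by ring
    have hqA : Polynomial.aeval A q ∈ almostInvariant b :=
      Algebra.adjoin_le (by simpa using hA) (Polynomial.aeval_mem_adjoin_singleton ℂ A)
    have h := (hqA.const_mul ‖A‖).add (ih.const_mul ‖A‖)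
    simp only [mul_zero, add_zero] at h
    refine squeeze_zero (fun N => div_nonneg (hsNorm_nonneg _ _) (by positivity)) (fun N => ?_) h
    rw [← mul_div_assoc, ← mul_div_assoc, ← add_div, hq, map_mul _ .X q, map_mul _ .X q,
      Polynomial.aeval_X, Polynomial.aeval_X]
    gcongr
    have h1 := hsNorm_compress_mul_sub_le (K N) (b N) A (Polynomial.aeval A q)
    have h2 := hsNorm_comp_le (b N) (compress (K N) A)
      (compress (K N) (Polynomial.aeval A q) - Polynomial.aeval (compress (K N) A) q)
    have h3 := hsNorm_add_le (b N) (compress (K N) (A * Polynomial.aeval A q) -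
      compress (K N) A * compress (K N) (Polynomial.aeval A q)) (compress (K N) A ∘L
      (compress (K N) (Polynomial.aeval A q) - Polynomial.aeval (compress (K N) A) q))
    rw [← ContinuousLinearMap.mul_def] at h2 h3
    nth_rewrite 1 [mul_sub] at h3
    rw [sub_add_sub_cancel] at h3
    refine h3.trans (add_le_add h1 (h2.trans ?_))
    exact mul_le_mul_of_nonneg_right (norm_compress_le _ _) (hsNorm_nonneg _ _)

lemma tendsto_tr_compress_aeval_sub {b : ∀ N, OrthonormalBasis (Fin N) ℂ (K N)}
    {A : H →L[ℂ] H} (hA : A ∈ almostInvariant b) (p : Polynomial ℂ) :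
    Tendsto (fun N : ℕ => ‖(1 / (N : ℂ)) * tr (Polynomial.aeval (compress (K N) A) p) -
      (1 / (N : ℂ)) * tr (compress (K N) (Polynomial.aeval A p))‖) atTop (𝓝 0) := by
  refine squeeze_zero (fun N => norm_nonneg _) (fun N => ?_)
    (tendsto_hsNorm_compress_aeval_sub hA p)
  have h1 := norm_tr_le_hsNorm (b N) (compress (K N) (Polynomial.aeval A p) -
    Polynomial.aeval (compress (K N) A) p)
  rw [← mul_sub, norm_mul, norm_sub_rev]
  have h2 : tr (compress (K N) (Polynomial.aeval A p) - Polynomial.aeval (compress (K N) A) p) =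
      tr (compress (K N) (Polynomial.aeval A p)) - tr (Polynomial.aeval (compress (K N) A) p) := by
    simp [tr]
  rw [h2, Fintype.card_fin] at h1
  refine (mul_le_mul_of_nonneg_left h1 (norm_nonneg _)).trans_eq ?_
  rcases Nat.eq_zero_or_pos N with rfl | hN
  · simp
  have h0 : 0 < √(N : ℝ) := Real.sqrt_pos.2 (by exact_mod_cast hN)
  have h3 : ‖(1 / (N : ℂ))‖ = 1 / (√(N : ℝ) * √(N : ℝ)) := by
    rw [Real.mul_self_sqrt (by positivity)]; simp
  rw [h3]
  field_simp

end AlmostInvariant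

/-! ### Polynomial approximation on compact convex sets. -/

section Runge

lemma map_circleIntegral {E F : Type*} [NormedAddCommGroup E] [NormedSpace ℂ E] [CompleteSpace E]
    [NormedAddCommGroup F] [NormedSpace ℂ F] [CompleteSpace F] (L : E →L[ℂ] F) {g : ℂ → E}
    {c : ℂ} {R : ℝ} (hg : CircleIntegrable g c R) :
    L (∮ z in C(c, R), g z) = ∮ z in C(c, R), L (g z) := by
  simp only [circleIntegral]
  rw [← L.intervalIntegral_comp_comm hg.out]
  simp

/-- A continuous family of continuous functions on a compact space which depends holomorphically
on a parameter at each point is analytic as a map into the space of continuous functions. -/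
lemma analyticAt_of_continuousOn_of_eval {X : Type*} [TopologicalSpace X] [CompactSpace X]
    {V : Set ℂ} (hV : IsOpen V) {γ : ℂ → C(X, ℂ)} (hγ : ContinuousOn γ V)
    (hd : ∀ x, DifferentiableOn ℂ (fun t => γ t x) V) {t₀ : ℂ} (ht₀ : t₀ ∈ V) :
    AnalyticAt ℂ γ t₀ := by
  obtain ⟨R, hR, hRV⟩ := Metric.nhds_basis_closedBall.mem_iff.1 (hV.mem_nhds ht₀)
  lift R to NNReal using hR.le
  have hci : CircleIntegrable γ t₀ R :=
    (hγ.mono (Metric.sphere_subset_closedBall.trans hRV)).circleIntegrable R.2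
  -- The vector-valued Cauchy integral is analytic; evaluation at each `x` reduces its equality with
  -- `γ` to the scalar Cauchy formula.
  have h := (hasFPowerSeriesOn_cauchy_integral hci (by exact_mod_cast hR)).analyticAt
  refine h.congr ?_
  filter_upwards [Metric.ball_mem_nhds t₀ hR] with t ht
  have hci' : CircleIntegrable (fun z => (z - t)⁻¹ • γ z) t₀ R := by
    refine ContinuousOn.circleIntegrable R.2 (ContinuousOn.fun_smul ?_
      (hγ.mono (Metric.sphere_subset_closedBall.trans hRV)))
    refine ContinuousOn.inv₀ (by fun_prop) fun z hz h0 => ?_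
    rw [sub_eq_zero] at h0
    rw [h0, Metric.mem_sphere] at hz
    exact (Metric.mem_ball.1 ht).ne hz
  ext x
  have h1 := map_circleIntegral (ContinuousMap.evalCLM ℂ x) hci'
  have h2 : DiffContOnCl ℂ (fun t => γ t x) (Metric.ball t₀ R) :=
    ((hd x).mono hRV).diffContOnCl_ball subset_rfl
  have h3 := h2.two_pi_i_inv_smul_circleIntegral_sub_inv_smul ht
  simp only [ContinuousMap.evalCLM_apply, ContinuousMap.smul_apply] at h1
  rw [ContinuousMap.smul_apply, h1, h3]

/-- The closure of the polynomials in `C(K)`. -/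
def polynomialClosure (K : Set ℂ) [CompactSpace K] : Submodule ℂ C(K, ℂ) :=
  Subalgebra.toSubmodule (polynomialFunctions K).topologicalClosure

instance (K : Set ℂ) [CompactSpace K] : IsClosed (polynomialClosure K : Set C(K, ℂ)) :=
  (polynomialFunctions K).isClosed_topologicalClosure

lemma mem_polynomialClosure_of_dist {K : Set ℂ} [CompactSpace K] {g : C(K, ℂ)}
    (h : ∀ ε : ℝ, 0 < ε → ∃ p : Polynomial ℂ, ∀ z : K, dist (g z) (p.eval (z : ℂ)) ≤ ε) :
    g ∈ polynomialClosure K := by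
  refine Metric.mem_closure_iff.2 fun ε hε => ?_
  obtain ⟨p, hp⟩ := h (ε / 2) (by positivity)
  refine ⟨p.toContinuousMapOn K, ⟨p, trivial, rfl⟩, ?_⟩
  refine lt_of_le_of_lt ((ContinuousMap.dist_le (by positivity)).2 fun z => ?_) (half_lt_self hε)
  simpa using hp z

lemma exists_polynomial_of_mem_polynomialClosure {K : Set ℂ} [CompactSpace K] {g : C(K, ℂ)}
    (h : g ∈ polynomialClosure K) {ε : ℝ} (hε : 0 < ε) :
    ∃ p : Polynomial ℂ, ∀ z : K, dist (g z) (p.eval (z : ℂ)) < ε := by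
  obtain ⟨_, ⟨p, -, rfl⟩, hp⟩ := Metric.mem_closure_iff.1 h ε hε
  exact ⟨p, fun z => by simpa using (ContinuousMap.dist_apply_le_dist z).trans_lt hp⟩

/-- **Runge's theorem** for a compact convex set: a function holomorphic on a neighbourhood is a
uniform limit of polynomials. -/
theorem exists_polynomial_near_of_differentiableOn {K U : Set ℂ} (hK : IsCompact K)
    (hKc : Convex ℝ K) (hU : IsOpen U) (hKU : K ⊆ U) {f : ℂ → ℂ} (hf : DifferentiableOn ℂ f U)
    {ε : ℝ} (hε : 0 < ε) : ∃ p : Polynomial ℂ, ∀ z ∈ K, ‖f z - p.eval z‖ < ε := by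
  rcases K.eq_empty_or_nonempty with rfl | ⟨c, hc⟩
  · exact ⟨0, by simp⟩
  have : CompactSpace K := isCompact_iff_compactSpace.1 hK
  -- These are the complex factors by which `K` can be dilated about `c` while staying in `U`;
  -- convexity puts the segment from 0 to 1 among them.
  let V : Set ℂ := {t | ∀ z ∈ K, c + t * (z - c) ∈ U}
  have hV : IsOpen V := by
    rw [isOpen_iff_mem_nhds]
    intro t ht
    refine hK.eventually_forall_of_forall_eventually fun z hz => ?_
    have : Continuous fun q : ℂ × ℂ => c + q.1 * (q.2 - c) := by fun_prop
    exact this.continuousAt.eventually (hU.mem_nhds (ht z hz))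
  let G : C(V × K, ℂ) := ⟨fun q => f (c + q.1 * (q.2 - c)), hf.continuousOn.comp_continuous
    (by fun_prop) fun q => q.1.2 _ q.2.2⟩
  classical
  let γ : ℂ → C(K, ℂ) := fun t => if h : t ∈ V then G.curry ⟨t, h⟩ else 0
  have hγV {t : ℂ} (ht : t ∈ V) (z : K) : γ t z = f (c + t * (z - c)) := by
    simp [γ, ht, G]
  have hγ : ContinuousOn γ V := by
    rw [continuousOn_iff_continuous_domRestrict]
    convert G.curry.continuous using 1
    ext1 t
    simp [γ]
  have hd (z : K) : DifferentiableOn ℂ (fun t => γ t z) V := by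
    have h1 : DifferentiableOn ℂ (fun t : ℂ => f (c + t * (z - c))) V :=
      hf.comp (by fun_prop) fun t ht => ht z z.2
    exact h1.congr fun t ht => hγV ht z
  -- Modulo the closed space of uniform limits of polynomials, the dilates of `f` form an analytic
  -- curve. It vanishes near `t = 0`, so the identity theorem along the segment makes it vanish at
  -- `t = 1`.
  let q := (polynomialClosure K).mkQL
  let I : Set ℂ := segment ℝ 0 1
  have hIV : I ⊆ V := by
    rintro t ht z hz
    rw [show I = segment ℝ 0 1 from rfl, segment_eq_image'] at ht
    obtain ⟨s, hs, rfl⟩ := ht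
    refine hKU ?_
    have := hKc.add_smul_sub_mem hc hz hs
    simpa using this
  have han : AnalyticOnNhd ℂ (fun t => q (γ t)) I := fun t ht =>
    (q.analyticAt _).comp (analyticAt_of_continuousOn_of_eval hV hγ hd (hIV ht))
  -- For small `t` the dilated set lies in a disc where the Taylor series of `f` at `c` converges
  -- uniformly; its partial sums are polynomials in `z`.
  have hzero : (fun t => q (γ t)) =ᶠ[𝓝 0] 0 := by
    obtain ⟨s, r, hr⟩ := hf.analyticAt (hU.mem_nhds (hKU hc))
    obtain ⟨r', hr'0, hr'⟩ := ENNReal.lt_iff_exists_nnreal_btwn.1 hr.r_pos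
    have hunif := hr.tendstoUniformlyOn hr'
    have h0V : V ∈ 𝓝 (0 : ℂ) := hV.mem_nhds (hIV (left_mem_segment ℝ 0 1))
    have hsmall : ∀ᶠ t : ℂ in 𝓝 0, ∀ z ∈ K, t * (z - c) ∈ Metric.ball (0 : ℂ) r' := by
      refine hK.eventually_forall_of_forall_eventually fun z hz => ?_
      have : Continuous fun q : ℂ × ℂ => q.1 * (q.2 - c) := by fun_prop
      refine this.continuousAt.eventually (Metric.isOpen_ball.mem_nhds ?_)
      simpa using hr'0
    filter_upwards [h0V, hsmall] with t htV ht
    refine (Submodule.Quotient.mk_eq_zero _).2 (mem_polynomialClosure_of_dist fun ε hε => ?_)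
    obtain ⟨n, hn⟩ := (Metric.tendstoUniformlyOn_iff.1 hunif ε hε).exists
    refine ⟨∑ k ∈ Finset.range n, .C (s.coeff k) * (.C t * (.X - .C c)) ^ k, fun z => ?_⟩
    have h1 := hn _ (ht z z.2)
    rw [hγV htV]
    refine le_of_eq_of_le ?_ h1.le
    congr 1
    simp [FormalMultilinearSeries.partialSum, Polynomial.eval_finsetSum, mul_comm]
  have h1 := han.eqOn_zero_of_preconnected_of_eventuallyEq_zero
    (convex_segment 0 1).isPreconnected (left_mem_segment ℝ 0 1) hzero (right_mem_segment ℝ 0 1)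
  have h2 : γ 1 ∈ polynomialClosure K := (Submodule.Quotient.mk_eq_zero _).1 h1
  obtain ⟨p, hp⟩ := exists_polynomial_of_mem_polynomialClosure h2 hε
  refine ⟨p, fun z hz => ?_⟩
  have h3 := hp ⟨z, hz⟩
  rw [hγV (hIV (right_mem_segment ℝ 0 1))] at h3
  simpa [dist_eq_norm] using h3

lemma exists_polynomial_near_of_continuousOn_Icc {a b : ℝ} {f : ℝ → ℂ}
    (hf : ContinuousOn f (Set.Icc a b)) {ε : ℝ} (hε : 0 < ε) :
    ∃ p : Polynomial ℂ, ∀ x ∈ Set.Icc a b, ‖f x - p.eval (x : ℂ)‖ < ε := by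
  obtain ⟨p, hp⟩ := exists_polynomial_near_of_continuousOn a b (fun x => (f x).re)
    (Complex.continuous_re.comp_continuousOn hf) (ε / 2) (by positivity)
  obtain ⟨q, hq⟩ := exists_polynomial_near_of_continuousOn a b (fun x => (f x).im)
    (Complex.continuous_im.comp_continuousOn hf) (ε / 2) (by positivity)
  refine ⟨p.map Complex.ofRealHom + .C Complex.I * q.map Complex.ofRealHom, fun x hx => ?_⟩
  have he (r : Polynomial ℝ) : (r.map Complex.ofRealHom).eval (x : ℂ) = ((r.eval x : ℝ) : ℂ) := by
    rw [← Complex.ofRealHom_eq_coe, Polynomial.eval_map_apply, Complex.ofRealHom_eq_coe]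
  refine (Complex.norm_le_abs_re_add_abs_im _).trans_lt ?_
  have h1 := hp x hx
  have h2 := hq x hx
  rw [abs_sub_comm] at h1 h2
  simp [he]
  linarith

end Runge

/-! ### Traces of functions of an operator via generalized eigenspaces. -/

section HolomorphicTrace

variable {E : Type*} [NormedAddCommGroup E] [NormedSpace ℂ E] [FiniteDimensional ℂ E]

/-- The algebraic multiplicity of `μ` as an eigenvalue of `T`. -/
def algMult (T : E →L[ℂ] E) (μ : ℂ) : ℕ :=
  Module.finrank ℂ (Module.End.maxGenEigenspace (T : E →ₗ[ℂ] E) μ)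

lemma spectrum_eq_spectrum_toLinearMap (T : E →L[ℂ] E) :
    spectrum ℂ T = spectrum ℂ (T : E →ₗ[ℂ] E) :=
  AlgEquiv.spectrum_eq (Module.End.toContinuousLinearMap E) (T : E →ₗ[ℂ] E)

lemma finite_spectrum (T : E →L[ℂ] E) : (spectrum ℂ T).Finite := by
  rw [spectrum_eq_spectrum_toLinearMap]
  exact Module.End.finite_spectrum _

lemma mem_spectrum_iff_maxGenEigenspace_ne_bot (T : E →L[ℂ] E) (μ : ℂ) :
    μ ∈ spectrum ℂ T ↔ Module.End.maxGenEigenspace (T : E →ₗ[ℂ] E) μ ≠ ⊥ := by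
  rw [spectrum_eq_spectrum_toLinearMap, ← Module.End.hasEigenvalue_iff_mem_spectrum]
  exact (Module.End.hasUnifEigenvalue_iff_hasUnifEigenvalue_one (k := ⊤) (by simp)).symm

/-- The trace of an operator commuting with `T` is the sum of its traces over the generalized
eigenspaces of `T`. -/
lemma tr_eq_sum_of_trace_restrict (T S : E →L[ℂ] E) (hTS : Commute T S) (a : ℂ → ℂ)
    (h : ∀ (μ : ℂ) (_ : μ ∈ spectrum ℂ T)
      (hS : Set.MapsTo (S : E →ₗ[ℂ] E) (Module.End.maxGenEigenspace (T : E →ₗ[ℂ] E) μ)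
        (Module.End.maxGenEigenspace (T : E →ₗ[ℂ] E) μ)),
      LinearMap.trace ℂ _ ((S : E →ₗ[ℂ] E).restrict hS) = a μ * algMult T μ) :
    tr S = ∑ μ ∈ (finite_spectrum T).toFinset, a μ * algMult T μ := by
  classical
  set L : Module.End ℂ E := (T : E →ₗ[ℂ] E)
  have hcomm : Commute L (S : E →ₗ[ℂ] E) := by
    have := congrArg (fun A : E →L[ℂ] E => (A : E →ₗ[ℂ] E)) hTS.eq
    exact this
  have hS := L.mapsTo_maxGenEigenspace_of_comm hcomm
  have hds := DirectSum.isInternal_submodule_of_iSupIndep_of_iSup_eq_top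
    L.independent_maxGenEigenspace (Module.End.iSup_maxGenEigenspace_eq_top L)
  have hfin : {μ | L.maxGenEigenspace μ ≠ ⊥}.Finite :=
    WellFoundedGT.finite_ne_bot_of_iSupIndep L.independent_maxGenEigenspace
  have hset : hfin.toFinset = (finite_spectrum T).toFinset := by
    ext μ
    simp [mem_spectrum_iff_maxGenEigenspace_ne_bot, L]
  rw [tr, LinearMap.trace_eq_sum_trace_restrict' hds hfin hS, hset]
  refine Finset.sum_congr rfl fun μ hμ => h μ (by simpa using hμ) (hS μ)

/-- On the generalized eigenspace `T - μ` is nilpotent and commutes with `S`, so `S (T - μ)` is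
nilpotent and has trace zero. -/
lemma trace_restrict_mul (T S : E →L[ℂ] E) (hTS : Commute T S) (μ : ℂ)
    (hS : Set.MapsTo (S : E →ₗ[ℂ] E) (Module.End.maxGenEigenspace (T : E →ₗ[ℂ] E) μ)
      (Module.End.maxGenEigenspace (T : E →ₗ[ℂ] E) μ))
    (hST : Set.MapsTo ((S * T : E →L[ℂ] E) : E →ₗ[ℂ] E)
      (Module.End.maxGenEigenspace (T : E →ₗ[ℂ] E) μ)
      (Module.End.maxGenEigenspace (T : E →ₗ[ℂ] E) μ)) :
    LinearMap.trace ℂ _ (((S * T : E →L[ℂ] E) : E →ₗ[ℂ] E).restrict hST) =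
      μ * LinearMap.trace ℂ _ ((S : E →ₗ[ℂ] E).restrict hS) := by
  set L : Module.End ℂ E := (T : E →ₗ[ℂ] E)
  have hcomm : Commute L (S : E →ₗ[ℂ] E) := by
    have := congrArg (fun A : E →L[ℂ] E => (A : E →ₗ[ℂ] E)) hTS.eq
    exact this
  have hL := L.mapsTo_maxGenEigenspace_of_comm (Commute.refl L) μ
  have h1 : Commute ((S : E →ₗ[ℂ] E).restrict hS) (L.restrict hL) :=
    LinearMap.restrict_commute hcomm.symm _ _
  rw [← LinearMap.trace_comp_eq_mul_of_commute_of_isNilpotent μ h1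
    (L.isNilpotent_restrict_maxGenEigenspace_sub_algebraMap μ)]
  rfl

lemma tr_pow_eq_sum (T : E →L[ℂ] E) (n : ℕ) :
    tr (T ^ n) = ∑ μ ∈ (finite_spectrum T).toFinset, μ ^ n * algMult T μ := by
  refine tr_eq_sum_of_trace_restrict T (T ^ n) ((Commute.refl T).pow_right n) (· ^ n)
    fun μ _ => ?_
  induction n with
  | zero =>
    intro hS
    have : (((T ^ 0 : E →L[ℂ] E) : E →ₗ[ℂ] E).restrict hS) = LinearMap.id := rfl
    rw [this, LinearMap.trace_id, pow_zero, one_mul, algMult]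
  | succ n ih =>
    intro hS
    have h1 : Commute (T : E →ₗ[ℂ] E) ((T ^ n : E →L[ℂ] E) : E →ₗ[ℂ] E) :=
      congrArg (fun A : E →L[ℂ] E => (A : E →ₗ[ℂ] E)) ((Commute.refl T).pow_right n).eq
    have h2 := Module.End.mapsTo_maxGenEigenspace_of_comm h1 μ
    have h3 := trace_restrict_mul T (T ^ n) ((Commute.refl T).pow_right n) μ h2 hS
    rw [ih h2] at h3
    exact h3.trans (by ring)

lemma tr_aeval_eq_sum (T : E →L[ℂ] E) (p : Polynomial ℂ) :
    tr (Polynomial.aeval T p) = ∑ μ ∈ (finite_spectrum T).toFinset, p.eval μ * algMult T μ := by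
  induction p using Polynomial.induction_on' with
  | add p q hp hq =>
    rw [map_add, show tr (Polynomial.aeval T p + Polynomial.aeval T q) =
      tr (Polynomial.aeval T p) + tr (Polynomial.aeval T q) by simp [tr], hp, hq,
      ← Finset.sum_add_distrib]
    simp [add_mul]
  | monomial n a =>
    rw [Polynomial.aeval_monomial, ← Algebra.smul_def,
      show tr (a • T ^ n) = a * tr (T ^ n) by simp [tr], tr_pow_eq_sum, Finset.mul_sum]
    simp [mul_assoc]

lemma sum_algMult (T : E →L[ℂ] E) :
    ∑ μ ∈ (finite_spectrum T).toFinset, algMult T μ = Module.finrank ℂ E := by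
  have h := tr_pow_eq_sum T 0
  have h1 : tr (T ^ 0) = Module.finrank ℂ E := LinearMap.trace_id ℂ E
  rw [h1] at h
  simp only [pow_zero, one_mul] at h
  exact_mod_cast h.symm

/-- Restricting `z R - R T = 1` to a generalized eigenspace and taking traces gives `(z - μ) Tr R =
algMult T μ`. -/
lemma tr_resolvent_eq_sum (T : E →L[ℂ] E) {z : ℂ} (hz : z ∉ spectrum ℂ T) :
    tr (resolvent T z) = ∑ μ ∈ (finite_spectrum T).toFinset, (z - μ)⁻¹ * algMult T μ := by
  have hu : IsUnit (algebraMap ℂ (E →L[ℂ] E) z - T) := by simpa [spectrum.mem_iff] using hz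
  have hc : Commute T (resolvent T z) := by
    have h : Commute T (hu.unit : E →L[ℂ] E) :=
      (Algebra.commute_algebraMap_right z T).sub_right (Commute.refl T)
    have h' : resolvent T z = ((hu.unit⁻¹ : (E →L[ℂ] E)ˣ) : E →L[ℂ] E) := Ring.inverse_unit hu.unit
    exact h' ▸ h.units_inv_right
  refine tr_eq_sum_of_trace_restrict T _ hc (fun μ => (z - μ)⁻¹) fun μ hμ hS => ?_
  have hne : z - μ ≠ 0 := fun h => hz (sub_eq_zero.1 h ▸ hμ)
  have h1 : Commute (T : E →ₗ[ℂ] E) ((resolvent T z * T : E →L[ℂ] E) : E →ₗ[ℂ] E) :=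
    congrArg (fun A : E →L[ℂ] E => (A : E →ₗ[ℂ] E)) (hc.mul_right (Commute.refl T)).eq
  have h2 := Module.End.mapsTo_maxGenEigenspace_of_comm h1 μ
  have h3 := trace_restrict_mul T _ hc μ hS h2
  have h4 : z • resolvent T z - resolvent T z * T = 1 := by
    have := Ring.inverse_mul_cancel _ hu
    rwa [mul_sub, ← Algebra.commutes, ← Algebra.smul_def] at this
  have h5 : z • ((resolvent T z : E →L[ℂ] E) : E →ₗ[ℂ] E).restrict hS -
      ((resolvent T z * T : E →L[ℂ] E) : E →ₗ[ℂ] E).restrict h2 = LinearMap.id := by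
    ext x
    exact congrArg (fun A : E →L[ℂ] E => A x) h4
  have h6 := congrArg (LinearMap.trace ℂ _) h5
  rw [map_sub, map_smul, h3, LinearMap.trace_id, smul_eq_mul, ← sub_mul] at h6
  rw [algMult, ← h6, inv_mul_cancel_left₀ hne]

/-- The trace as a continuous linear functional. -/
def trCLM (E : Type*) [NormedAddCommGroup E] [NormedSpace ℂ E] [FiniteDimensional ℂ E] :
    (E →L[ℂ] E) →L[ℂ] ℂ :=
  LinearMap.toContinuousLinearMap
    (LinearMap.trace ℂ E ∘ₗ (Module.End.toContinuousLinearMap E).symm.toLinearMap)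

lemma trCLM_apply (S : E →L[ℂ] E) : trCLM E S = tr S := rfl

lemma differentiableAt_smul_resolvent {T : E →L[ℂ] E} {f : ℂ → ℂ} {U : Set ℂ} (hU : IsOpen U)
    (hf : DifferentiableOn ℂ f U) {z : ℂ} (hzU : z ∈ U) (hz : z ∉ spectrum ℂ T) :
    DifferentiableAt ℂ (fun z => f z • resolvent T z) z := by
  have : CompleteSpace E := FiniteDimensional.complete ℂ E
  exact (hf.differentiableAt (hU.mem_nhds hzU)).smul
    (spectrum.hasDerivAt_resolvent_const_left (by simpa [spectrum] using hz)).differentiableAt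

/-- The trace of `f(T)` is the sum of the values of `f` at the eigenvalues of `T`. -/
theorem tr_holFC (T : E →L[ℂ] E) {f : ℂ → ℂ} {U : Set ℂ} (hU : IsOpen U)
    (hf : DifferentiableOn ℂ f U) (hT : spectrum ℂ T ⊆ U) :
    tr (holFC f T) = ∑ μ ∈ (finite_spectrum T).toFinset, f μ * algMult T μ := by
  have : CompleteSpace E := FiniteDimensional.complete ℂ E
  have hfin := finite_spectrum T
  -- Small closed discs stay in `U` and meet the spectrum only at their centre. The contour
  -- integrals are then independent of `r`, so the limit in `holFC` is the value at any such radius.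
  have hsmall : ∀ᶠ r in 𝓝[>] (0 : ℝ), ∀ μ ∈ spectrum ℂ T,
      Metric.closedBall μ r ⊆ U ∩ (spectrum ℂ T \ {μ})ᶜ := by
    rw [Filter.eventually_all_finite hfin]
    intro μ hμ
    have hopen : IsOpen (U ∩ (spectrum ℂ T \ {μ})ᶜ) :=
      hU.inter (hfin.subset Set.sdiff_subset).isClosed.isOpen_compl
    exact (eventually_closedBall_subset (hopen.mem_nhds ⟨hT hμ, by simp⟩)).filter_mono
      nhdsWithin_le_nhds
  obtain ⟨R, hR, hR0⟩ := (hsmall.and self_mem_nhdsWithin).exists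
  have hR0 : 0 < R := hR0
  have hdiff (μ : ℂ) (hμ : μ ∈ spectrum ℂ T) (z : ℂ) (hz : z ∈ Metric.closedBall μ R)
      (hzμ : z ≠ μ) : DifferentiableAt ℂ (fun z => f z • resolvent T z) z :=
    differentiableAt_smul_resolvent hU hf (hR μ hμ hz).1 fun h => (hR μ hμ hz).2 ⟨h, hzμ⟩
  let F : ℝ → E →L[ℂ] E := fun r => (2 * (Real.pi : ℂ) * Complex.I)⁻¹ •
      ∑ᶠ μ ∈ spectrum ℂ T, ∮ z in C(μ, r), f z • resolvent T z
  have hconst : ∀ᶠ r in 𝓝[>] (0 : ℝ), F r = F R := by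
    filter_upwards [Ioc_mem_nhdsGT hR0] with r hr
    simp only [F]
    congr 1
    refine finsum_mem_congr rfl fun μ hμ => ?_
    refine (Complex.circleIntegral_eq_of_differentiable_on_annulus_off_countable hr.1 hr.2
      Set.countable_empty ?_ ?_).symm
    · intro z hz
      refine (hdiff μ hμ z hz.1 ?_).continuousAt.continuousWithinAt
      rintro rfl
      exact hz.2 (Metric.mem_ball_self hr.1)
    · intro z hz
      refine hdiff μ hμ z (Metric.ball_subset_closedBall hz.1.1) ?_
      rintro rfl
      exact hz.1.2 (Metric.mem_closedBall_self hr.1.le)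
  have hlim : holFC f T = F R :=
    (Filter.Tendsto.congr' (hconst.mono fun r hr => hr.symm) tendsto_const_nhds).limUnder_eq
  rw [hlim, ← trCLM_apply, map_smul, finsum_mem_eq_finite_toFinset_sum _ hfin, map_sum,
    smul_eq_mul, Finset.mul_sum]
  refine Finset.sum_congr rfl fun μ hμ => ?_
  replace hμ : μ ∈ spectrum ℂ T := by simpa using hμ
  have hsph (z : ℂ) (hz : z ∈ Metric.sphere μ R) : z ∉ spectrum ℂ T := fun h =>
    (hR μ hμ (Metric.sphere_subset_closedBall hz)).2 ⟨h, Metric.ne_of_mem_sphere hz hR0.ne'⟩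
  have hfball : DifferentiableOn ℂ f (Metric.closedBall μ R) :=
    hf.mono fun z hz => (hR μ hμ hz).1
  have hci : CircleIntegrable (fun z => f z • resolvent T z) μ R :=
    ContinuousOn.circleIntegrable hR0.le fun z hz =>
      (hdiff μ hμ z (Metric.sphere_subset_closedBall hz)
        (Metric.ne_of_mem_sphere hz hR0.ne')).continuousAt.continuousWithinAt
  have hcont (μ' : ℂ) (hμ' : μ' ∈ spectrum ℂ T) :
      ContinuousOn (fun z => (z - μ')⁻¹ • f z) (Metric.sphere μ R) := by
    refine ContinuousOn.fun_smul (ContinuousOn.fun_inv₀ (by fun_prop) fun z hz h0 => ?_)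
      (hfball.continuousOn.mono Metric.sphere_subset_closedBall)
    exact hsph z hz (sub_eq_zero.1 h0 ▸ hμ')
  -- Only the pole at the centre of the contour contributes, by Cauchy's formula; the other terms
  -- are holomorphic on the closed disc.
  have hint (μ' : ℂ) (hμ' : μ' ∈ spectrum ℂ T) :
      (∮ z in C(μ, R), (z - μ')⁻¹ • f z) =
        if μ' = μ then (2 * (Real.pi : ℂ) * Complex.I) * f μ else 0 := by
    split_ifs with h
    · subst h
      simpa using hfball.circleIntegral_sub_inv_smul (Metric.mem_ball_self hR0)
    · have hd : DifferentiableOn ℂ (fun z => (z - μ')⁻¹ • f z) (Metric.closedBall μ R) := by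
        refine DifferentiableOn.fun_smul (DifferentiableOn.fun_inv (by fun_prop) fun z hz h0 => ?_) hfball
        rw [sub_eq_zero] at h0
        exact (hR μ hμ hz).2 (h0 ▸ ⟨hμ', h⟩)
      exact (hd.diffContOnCl_ball subset_rfl).circleIntegral_eq_zero hR0.le
  have h2 : ∮ z in C(μ, R), trCLM E (f z • resolvent T z) =
      ∮ z in C(μ, R), ∑ μ' ∈ hfin.toFinset, (algMult T μ' : ℂ) • ((z - μ')⁻¹ • f z) := by
    refine circleIntegral.integral_congr hR0.le fun z hz => ?_
    simp only [map_smul, trCLM_apply]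
    rw [tr_resolvent_eq_sum T (hsph z hz), Finset.smul_sum]
    refine Finset.sum_congr rfl fun μ' _ => ?_
    simp only [smul_eq_mul]
    ring
  rw [map_circleIntegral (trCLM E) hci, h2, circleIntegral.integral_fun_sum fun μ' hμ' =>
    (ContinuousOn.circleIntegrable hR0.le ((hcont μ' (by simpa using hμ')).fun_const_smul _))]
  simp only [circleIntegral.integral_smul]
  rw [Finset.sum_congr rfl fun μ' hμ' => by rw [hint μ' (by simpa using hμ')]]
  have hpi : (2 * (Real.pi : ℂ) * Complex.I) ≠ 0 := Complex.two_pi_I_ne_zero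
  simp only [smul_eq_mul, mul_ite, mul_zero, Finset.sum_ite_eq', Set.Finite.mem_toFinset, hμ,
    if_true]
  field_simp

end HolomorphicTrace

/-! ### Multiplication operators on `L²(𝕋)`. -/

section Multiplication

lemma coeFn_mulOp (φ : Linf) (u : L2) : mulOp φ u =ᵐ[m] fun t => φ t * u t :=
  (ContinuousLinearMap.mul ℂ ℂ).coeFn_holder φ u

/-- Multiplication by a continuous function on `L²(𝕋)`. -/
def mulC : C(𝕋, ℂ) →L[ℂ] (L2 →L[ℂ] L2) :=
  (ContinuousLinearMap.mul ℂ ℂ).holderL m ∞ 2 2 ∘L ContinuousMap.toLp ∞ m ℂ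

lemma mulC_eq_mulOp (F : C(𝕋, ℂ)) : mulC F = mulOp (ContinuousMap.toLp ∞ m ℂ F) := rfl

lemma coeFn_mulC (F : C(𝕋, ℂ)) (u : L2) : mulC F u =ᵐ[m] fun t => F t * u t := by
  filter_upwards [coeFn_mulOp (ContinuousMap.toLp ∞ m ℂ F) u,
    ContinuousMap.coeFn_toLp (p := ∞) (𝕜 := ℂ) m F] with t h1 h2
  rw [mulC_eq_mulOp, h1, h2]

lemma mulC_mul (F G : C(𝕋, ℂ)) : mulC (F * G) = mulC F * mulC G := by
  ext1 u
  refine Lp.ext ?_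
  filter_upwards [coeFn_mulC (F * G) u, coeFn_mulC F (mulC G u), coeFn_mulC G u] with t h1 h2 h3
  rw [h1, mul_apply_eq_comp, h2, h3, ContinuousMap.mul_apply, mul_assoc]

lemma mulC_mul_apply (F G : C(𝕋, ℂ)) (u : L2) : mulC (F * G) u = mulC F (mulC G u) := by
  rw [mulC_mul]; rfl

@[simp]
lemma mulC_one : mulC 1 = 1 := by
  ext1 u
  refine Lp.ext ?_
  filter_upwards [coeFn_mulC 1 u] with t h1
  simp [h1]

lemma inner_mulC_left (F : C(𝕋, ℂ)) (u v : L2) :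
    inner ℂ (mulC F u) v = inner ℂ u (mulC (star F) v) := by
  rw [L2.inner_def, L2.inner_def]
  refine integral_congr_ae ?_
  filter_upwards [coeFn_mulC F u, coeFn_mulC (star F) v] with t h1 h2
  rw [h1, h2]
  simp only [RCLike.inner_apply, map_mul, ContinuousMap.star_apply, RCLike.star_def]
  ring

/-- The monomial `ζⁿ` as an element of `L²(𝕋)`. -/
def mono (n : ℤ) : L2 := fourierBasis n

lemma coeFn_mono (n : ℤ) : mono n =ᵐ[m] fourier n := by
  rw [mono, coe_fourierBasis]
  exact coeFn_fourierLp 2 n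

lemma inner_mono (i j : ℤ) : inner ℂ (mono i) (mono j) = if i = j then 1 else 0 :=
  orthonormal_iff_ite.1 (fourierBasis (T := 1)).orthonormal i j

lemma norm_mono (n : ℤ) : ‖mono n‖ = 1 := (fourierBasis (T := 1)).orthonormal.1 n

lemma mulC_fourier_mono (k n : ℤ) : mulC (fourier k) (mono n) = mono (n + k) := by
  refine Lp.ext ?_
  filter_upwards [coeFn_mulC (fourier k) (mono n), coeFn_mono n, coeFn_mono (n + k)] with t a b c
  rw [a, b, c, fourier_add, mul_comm]

lemma star_fourier (n : ℤ) : star (fourier n : C(𝕋, ℂ)) = fourier (-n) := by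
  ext t
  simp

lemma ext_of_inner_mono {u v : L2} (h : ∀ n, inner ℂ (mono n) u = inner ℂ (mono n) v) : u = v := by
  refine (fourierBasis (T := 1)).repr.injective (lp.ext (funext fun n => ?_))
  rw [HilbertBasis.repr_apply_apply, HilbertBasis.repr_apply_apply]
  exact h n

end Multiplication

/-! ### The Hardy space and its continuous multipliers. -/

section Hardy

lemma mem_hardy_iff {u : L2} : u ∈ hardy ↔ ∀ n : ℤ, n < 0 → inner ℂ (mono n) u = 0 := by
  refine forall_congr' fun n => forall_congr' fun _ => ?_
  rw [← fourierBasis_repr, HilbertBasis.repr_apply_apply]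
  rfl

instance : CompleteSpace hardy := isClosed_hardy.completeSpace_coe

lemma mono_mem_hardy {n : ℤ} (hn : 0 ≤ n) : mono n ∈ hardy :=
  mem_hardy_iff.2 fun k hk => by rw [inner_mono, if_neg (by omega)]

lemma inner_mono_fourier_mul (n k : ℤ) (u : L2) :
    inner ℂ (mono n) (mulC (fourier k) u) = inner ℂ (mono (n - k)) u := by
  rw [show (fourier k : C(𝕋, ℂ)) = star (fourier (-k)) by rw [star_fourier, neg_neg],
    ← inner_mulC_left, mulC_fourier_mono, sub_eq_add_neg]

/-- Division of a function in the Hardy space by `ζ`, after subtracting the constant term. -/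
lemma backwardShift_mem_hardy {u : L2} (hu : u ∈ hardy) :
    mulC (fourier (-1)) u - inner ℂ (mono 0) u • mono (-1) ∈ hardy := by
  refine mem_hardy_iff.2 fun n hn => ?_
  rw [inner_sub_right, inner_smul_right, inner_mono_fourier_mul, inner_mono, sub_neg_eq_add]
  split_ifs with h
  · simp [h]
  · rw [mem_hardy_iff.1 hu _ (by omega)]; simp

/-- The continuous multipliers of the Hardy space. -/
def multiplier : Subalgebra ℂ C(𝕋, ℂ) where
  carrier := {F | ∀ u ∈ hardy, mulC F u ∈ hardy}
  mul_mem' hF hG u hu := by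
    rw [mulC_mul_apply]
    exact hF _ (hG _ hu)
  add_mem' hF hG u hu := by
    rw [map_add]
    exact hardy.add_mem (hF u hu) (hG u hu)
  algebraMap_mem' c u hu := by
    rw [Algebra.algebraMap_eq_smul_one, map_smul, mulC_one]
    exact hardy.smul_mem c hu

lemma mem_multiplier {F : C(𝕋, ℂ)} : F ∈ multiplier ↔ ∀ u ∈ hardy, mulC F u ∈ hardy := Iff.rfl

/-- Closedness admits the Cauchy kernel, a norm-convergent geometric series in `ζ`. -/
lemma isClosed_multiplier : IsClosed (multiplier : Set C(𝕋, ℂ)) := by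
  have h : (multiplier : Set C(𝕋, ℂ)) = ⋂ u ∈ hardy, {F | mulC F u ∈ hardy} := by
    ext F
    simp [mem_multiplier]
  rw [h]
  exact isClosed_biInter fun u _ => isClosed_hardy.preimage (by fun_prop)

lemma fourier_one_mem_multiplier : (fourier 1 : C(𝕋, ℂ)) ∈ multiplier := by
  intro u hu
  refine mem_hardy_iff.2 fun n hn => ?_
  rw [inner_mono_fourier_mul]
  exact mem_hardy_iff.1 hu _ (by omega)

end Hardy

/-! ### Cauchy kernels and Blaschke products on the circle. -/

section Kernel

lemma norm_pt (t : 𝕋) : ‖pt t‖ = 1 := Circle.norm_coe _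

lemma fourier_one_apply (t : 𝕋) : (fourier 1 : C(𝕋, ℂ)) t = pt t := fourier_one

lemma one_sub_conj_mul_pt_ne_zero {l : ℂ} (hl : ‖l‖ < 1) (t : 𝕋) : 1 - conj l * pt t ≠ 0 := by
  intro h
  have h1 : ‖conj l * pt t‖ = 1 := by rw [← sub_eq_zero.1 h, norm_one]
  rw [norm_mul, norm_pt, mul_one, RCLike.norm_conj] at h1
  exact hl.ne h1

/-- On the circle `1 - conj l ζ = ζ conj (ζ - l)`. Hence Blaschke factors are unimodular and
normalized Cauchy kernels have the Poisson kernel as squared modulus. -/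
lemma norm_one_sub_conj_mul_pt (l : ℂ) (t : 𝕋) : ‖1 - conj l * pt t‖ = ‖pt t - l‖ := by
  have h : 1 - conj l * pt t = pt t * conj (pt t - l) := by
    have : pt t * conj (pt t) = 1 := by
      rw [Complex.mul_conj, Complex.normSq_eq_norm_sq, norm_pt]; simp
    rw [map_sub, mul_sub, this, mul_comm]
  rw [h, norm_mul, norm_pt, one_mul, RCLike.norm_conj]

lemma pt_sub_ne_zero {l : ℂ} (hl : ‖l‖ < 1) (t : 𝕋) : pt t - l ≠ 0 := by
  rw [← norm_ne_zero_iff, ← norm_one_sub_conj_mul_pt, norm_ne_zero_iff]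
  exact one_sub_conj_mul_pt_ne_zero hl t

/-- The denominator `1 - conj l ζ` of the Cauchy kernel. -/
def den (l : ℂ) : C(𝕋, ℂ) := 1 - conj l • fourier 1

lemma den_apply (l : ℂ) (t : 𝕋) : den l t = 1 - conj l * pt t := by
  simp [den, pt]

lemma den_mem_multiplier (l : ℂ) : den l ∈ multiplier :=
  multiplier.sub_mem multiplier.one_mem (multiplier.smul_mem fourier_one_mem_multiplier _)

/-- The Cauchy kernel `(1 - conj l ζ)⁻¹`. -/
def cauchyKer (l : ℂ) : C(𝕋, ℂ) := Ring.inverse (den l)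

lemma norm_conj_smul_fourier {l : ℂ} (hl : ‖l‖ < 1) :
    ‖conj l • (fourier 1 : C(𝕋, ℂ))‖ < 1 := by
  rwa [norm_smul, fourier_norm, mul_one, RCLike.norm_conj]

lemma isUnit_den {l : ℂ} (hl : ‖l‖ < 1) : IsUnit (den l) :=
  isUnit_one_sub_of_norm_lt_one (norm_conj_smul_fourier hl)

lemma den_mul_cauchyKer {l : ℂ} (hl : ‖l‖ < 1) : den l * cauchyKer l = 1 :=
  Ring.mul_inverse_cancel _ (isUnit_den hl)

lemma cauchyKer_apply {l : ℂ} (hl : ‖l‖ < 1) (t : 𝕋) :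
    cauchyKer l t = (1 - conj l * pt t)⁻¹ := by
  have h := congrArg (fun F : C(𝕋, ℂ) => F t) (den_mul_cauchyKer hl)
  simp only [ContinuousMap.mul_apply, ContinuousMap.one_apply, den_apply] at h
  exact eq_inv_of_mul_eq_one_right h

lemma cauchyKer_mem_multiplier {l : ℂ} (hl : ‖l‖ < 1) : cauchyKer l ∈ multiplier := by
  have h1 := norm_conj_smul_fourier hl
  have h2 : cauchyKer l = ∑' n : ℕ, (conj l • (fourier 1 : C(𝕋, ℂ))) ^ n :=
    NormedRing.inverse_one_sub _ h1
  have h3 := (summable_geometric_of_norm_lt_one h1).hasSum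
  rw [← h2] at h3
  refine isClosed_multiplier.mem_of_tendsto h3 (Eventually.of_forall fun s => ?_)
  exact multiplier.sum_mem fun n _ =>
    multiplier.pow_mem (multiplier.smul_mem fourier_one_mem_multiplier _) n

/-- The unimodular constant in a Blaschke factor. -/
def blaschkeConst (l : ℂ) : ℂ := if l = 0 then 1 else conj l / (‖l‖ : ℂ)

lemma norm_blaschkeConst (l : ℂ) : ‖blaschkeConst l‖ = 1 := by
  unfold blaschkeConst
  split_ifs with h
  · simp
  · have : ‖l‖ ≠ 0 := by simpa using h
    simp [div_self this]

lemma blaschkeConst_mul_conj (l : ℂ) : conj (blaschkeConst l) * blaschkeConst l = 1 := by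
  rw [mul_comm, Complex.mul_conj, Complex.normSq_eq_norm_sq, norm_blaschkeConst]; simp

/-- A Blaschke factor on the circle. -/
def blaschkeFactor (l : ℂ) : C(𝕋, ℂ) :=
  blaschkeConst l • ((fourier 1 - l • 1) * cauchyKer l)

lemma blaschkeFactor_mem_multiplier {l : ℂ} (hl : ‖l‖ < 1) : blaschkeFactor l ∈ multiplier :=
  multiplier.smul_mem (multiplier.mul_mem (multiplier.sub_mem fourier_one_mem_multiplier
    (multiplier.smul_mem multiplier.one_mem l)) (cauchyKer_mem_multiplier hl)) _

lemma blaschkeFactor_apply {l : ℂ} (hl : ‖l‖ < 1) (t : 𝕋) :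
    blaschkeFactor l t = blaschkeConst l * ((pt t - l) / (1 - conj l * pt t)) := by
  simp only [blaschkeFactor, ContinuousMap.smul_apply, ContinuousMap.mul_apply,
    ContinuousMap.sub_apply, ContinuousMap.one_apply, cauchyKer_apply hl,
    fourier_one_apply, smul_eq_mul, mul_one, div_eq_mul_inv]

lemma norm_blaschkeFactor {l : ℂ} (hl : ‖l‖ < 1) (t : 𝕋) : ‖blaschkeFactor l t‖ = 1 := by
  rw [blaschkeFactor_apply hl, norm_mul, norm_blaschkeConst, norm_div, norm_one_sub_conj_mul_pt,
    div_self (norm_ne_zero_iff.2 (pt_sub_ne_zero hl t)), one_mul]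

/-- The Blaschke product as a continuous function on the circle. -/
def blaschkeC (Λ : ℕ → ℂ) (N : ℕ) : C(𝕋, ℂ) := ∏ j ∈ Finset.range N, blaschkeFactor (Λ j)

variable {Λ : ℕ → ℂ}

lemma blaschkeC_apply (hΛ : ∀ j, ‖Λ j‖ < 1) (N : ℕ) (t : 𝕋) : blaschkeC Λ N t = blaschke Λ N (pt t) := by
  rw [blaschkeC, blaschke, ContinuousMap.prod_apply]
  exact Finset.prod_congr rfl fun j _ => blaschkeFactor_apply (hΛ j) t

lemma blaschkeC_mem_multiplier (hΛ : ∀ j, ‖Λ j‖ < 1) (N : ℕ) : blaschkeC Λ N ∈ multiplier :=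
  multiplier.prod_mem fun j _ => blaschkeFactor_mem_multiplier (hΛ j)

lemma norm_blaschkeC (hΛ : ∀ j, ‖Λ j‖ < 1) (N : ℕ) (t : 𝕋) : ‖blaschkeC Λ N t‖ = 1 := by
  rw [blaschkeC, ContinuousMap.prod_apply, norm_prod]
  exact Finset.prod_eq_one fun j _ => norm_blaschkeFactor (hΛ j) t

end Kernel

/-! ### Model spaces and the Takenaka–Malmquist basis. -/

section ModelSpace

lemma mulC_star_apply_mulC {F : C(𝕋, ℂ)} (hF : ∀ t, ‖F t‖ = 1) (u : L2) :
    mulC (star F) (mulC F u) = u := by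
  have : star F * F = 1 := by
    ext t
    have : conj (F t) * F t = 1 := by
      rw [mul_comm, Complex.mul_conj, Complex.normSq_eq_norm_sq, hF]; simp
    simpa using this
  rw [← mulC_mul_apply, this, mulC_one]
  rfl

lemma inner_mulC_mulC {F : C(𝕋, ℂ)} (hF : ∀ t, ‖F t‖ = 1) (u v : L2) :
    inner ℂ (mulC F u) (mulC F v) = inner ℂ u v := by
  rw [inner_mulC_left, mulC_star_apply_mulC hF]

lemma norm_mulC_apply {F : C(𝕋, ℂ)} (hF : ∀ t, ‖F t‖ = 1) (u : L2) : ‖mulC F u‖ = ‖u‖ := by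
  rw [norm_eq_sqrt_re_inner (𝕜 := ℂ), inner_mulC_mulC hF, ← norm_eq_sqrt_re_inner]

lemma norm_fourier_apply (n : ℤ) (t : 𝕋) : ‖(fourier n : C(𝕋, ℂ)) t‖ = 1 :=
  Circle.norm_coe _

lemma star_blaschkeFactor_mul_cauchyKer {l : ℂ} (hl : ‖l‖ < 1) :
    star (blaschkeFactor l) * cauchyKer l =
      conj (blaschkeConst l) • (star (cauchyKer l) * fourier (-1)) := by
  ext t
  have h1 := one_sub_conj_mul_pt_ne_zero hl t
  have h2 : pt t * conj (pt t) = 1 := by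
    rw [Complex.mul_conj, Complex.normSq_eq_norm_sq, norm_pt]; simp
  have h3 : (fourier (-1) : C(𝕋, ℂ)) t = conj (pt t) := by rw [fourier_neg, fourier_one_apply]
  have h4 : conj (pt t) - conj l = conj (pt t) * (1 - conj l * pt t) := by
    linear_combination (conj l) * h2
  simp only [ContinuousMap.mul_apply, ContinuousMap.star_apply, ContinuousMap.smul_apply,
    blaschkeFactor_apply hl, cauchyKer_apply hl, RCLike.star_def, map_mul, map_div₀, map_sub,
    smul_eq_mul, h3, map_inv₀, h4]
  field_simp

lemma sub_eq_blaschkeFactor_mul {l : ℂ} (hl : ‖l‖ < 1) :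
    fourier 1 - l • (1 : C(𝕋, ℂ)) = conj (blaschkeConst l) • (blaschkeFactor l * den l) := by
  rw [blaschkeFactor, smul_mul_assoc, smul_smul, blaschkeConst_mul_conj, one_smul, mul_assoc,
    mul_comm (cauchyKer l), den_mul_cauchyKer hl, mul_one]

/-- Up to a constant, moving the conjugated factors across turns this into the coefficient of index
`-1` of `cauchyKer l · g`, which lies in the Hardy space. -/
lemma inner_blaschkeFactor_cauchyKer {l : ℂ} (hl : ‖l‖ < 1) {g : L2} (hg : g ∈ hardy) :
    inner ℂ (mulC (blaschkeFactor l) g) (mulC (cauchyKer l) (mono 0)) = 0 := by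
  rw [inner_mulC_left, ← mulC_mul_apply, star_blaschkeFactor_mul_cauchyKer hl, map_smul,
    smul_apply, inner_smul_right, mulC_mul_apply, ← inner_mulC_left, mulC_fourier_mono,
    ← inner_conj_symm, mem_hardy_iff.1 (cauchyKer_mem_multiplier hl g hg) _ (by norm_num)]
  simp

/-- Pythagoras for `k = 1 + conj l ζ k`, whose two summands are orthogonal. -/
lemma norm_sq_cauchyKer {l : ℂ} (hl : ‖l‖ < 1) :
    (1 - ‖l‖ ^ 2) * ‖mulC (cauchyKer l) (mono 0)‖ ^ 2 = 1 := by
  set v := mulC (cauchyKer l) (mono 0)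
  have hv : v ∈ hardy := cauchyKer_mem_multiplier hl _ (mono_mem_hardy le_rfl)
  have h1 : v = mono 0 + conj l • mulC (fourier 1) v := by
    have h : mulC (den l) v = mono 0 := by
      rw [← mulC_mul_apply, den_mul_cauchyKer hl, mulC_one]; rfl
    rw [den, map_sub, map_smul, mulC_one] at h
    rw [← h]
    simp
  have h2 : inner ℂ (mono 0) (conj l • mulC (fourier 1) v) = 0 := by
    rw [inner_smul_right, inner_mono_fourier_mul, mem_hardy_iff.1 hv _ (by norm_num), mul_zero]
  have h3 := norm_add_sq_eq_norm_sq_add_norm_sq_of_inner_eq_zero _ _ h2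
  rw [← h1, norm_smul, norm_mulC_apply (norm_fourier_apply 1), norm_mono, RCLike.norm_conj] at h3
  linear_combination h3

/-- A function in the Hardy space that is orthogonal to the multiples of a Blaschke factor is a
multiple of the Cauchy kernel. -/
lemma exists_smul_cauchyKer {l : ℂ} (hl : ‖l‖ < 1) {g : L2} (hg : g ∈ hardy)
    (h : ∀ f ∈ hardy, inner ℂ (mulC (blaschkeFactor l) f) g = 0) :
    ∃ c : ℂ, g = c • mulC (cauchyKer l) (mono 0) := by
  -- It suffices that `(1 - conj l ζ) g` is constant, since dividing by the denominator then gives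
  -- the kernel.
  have hw : mulC (den l) g = inner ℂ (mono 0) (mulC (den l) g) • mono 0 := by
    refine ext_of_inner_mono fun n => ?_
    rw [inner_smul_right, inner_mono]
    split_ifs with hn
    · rw [hn, mul_one]
    rw [mul_zero]
    rcases lt_or_gt_of_ne hn with hn | hn
    · exact mem_hardy_iff.1 (den_mem_multiplier l g hg) n hn
    -- For `n > 0`, `conj (1 - conj l ζ) ζⁿ = (ζ - l) ζⁿ⁻¹` is a multiple of the Blaschke factor in
    -- the Hardy space, so the hypothesis kills this coefficient.
    · have h1 : mulC (star (den l)) (mono n) =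
          mulC (fourier 1 - l • (1 : C(𝕋, ℂ))) (mono (n - 1)) := by
        have : star (den l) = 1 - l • (fourier (-1) : C(𝕋, ℂ)) := by
          rw [den, star_sub, star_smul, star_fourier]; simp
        rw [this, map_sub, map_sub, map_smul, map_smul]
        simp only [mulC_one, sub_apply, smul_apply, mulC_fourier_mono, one_apply_eq_self]
        rw [sub_add_cancel, sub_eq_add_neg n 1]
      rw [← star_star (den l), ← inner_mulC_left, h1, sub_eq_blaschkeFactor_mul hl, map_smul,
        smul_apply, inner_smul_left, mulC_mul_apply,
        h _ (den_mem_multiplier l _ (mono_mem_hardy (by omega))), mul_zero]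
  refine ⟨inner ℂ (mono 0) (mulC (den l) g), ?_⟩
  rw [← map_smul, ← hw, ← mulC_mul_apply, mul_comm, den_mul_cauchyKer hl, mulC_one]
  rfl

variable {Λ : ℕ → ℂ}

lemma mem_mulHardy_iff (hΛ : ∀ j, ‖Λ j‖ < 1) {N : ℕ} {h : L2} :
    h ∈ mulHardy (fun t => blaschke Λ N (pt t)) ↔ ∃ g ∈ hardy, h = mulC (blaschkeC Λ N) g := by
  refine exists_congr fun g => and_congr_right fun _ => ⟨fun e => Lp.ext ?_, fun e => ?_⟩
  · filter_upwards [e, coeFn_mulC (blaschkeC Λ N) g] with t h1 h2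
    rw [h1, h2, blaschkeC_apply hΛ]
  · filter_upwards [coeFn_mulC (blaschkeC Λ N) g] with t h2
    rw [e, h2, blaschkeC_apply hΛ]

/-- The model space `K_{B_N}`. -/
abbrev modelN (Λ : ℕ → ℂ) (N : ℕ) : Submodule ℂ L2 := modelSpace fun t => blaschke Λ N (pt t)

lemma mem_modelN_iff (hΛ : ∀ j, ‖Λ j‖ < 1) {N : ℕ} {h : L2} :
    h ∈ modelN Λ N ↔ h ∈ hardy ∧ ∀ g ∈ hardy, inner ℂ (mulC (blaschkeC Λ N) g) h = 0 := by
  refine and_congr_right fun _ => ?_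
  rw [SetLike.mem_coe, Submodule.mem_orthogonal]
  refine ⟨fun H g hg => H _ ((mem_mulHardy_iff hΛ).2 ⟨g, hg, rfl⟩), fun H u hu => ?_⟩
  obtain ⟨g, hg, rfl⟩ := (mem_mulHardy_iff hΛ).1 hu
  exact H g hg

lemma blaschkeC_succ (Λ : ℕ → ℂ) (N : ℕ) :
    blaschkeC Λ (N + 1) = blaschkeC Λ N * blaschkeFactor (Λ N) :=
  Finset.prod_range_succ _ _

lemma modelN_mono (hΛ : ∀ j, ‖Λ j‖ < 1) : Monotone (modelN Λ) := by
  refine monotone_nat_of_le_succ fun N h hh => ?_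
  rw [mem_modelN_iff hΛ] at hh ⊢
  refine ⟨hh.1, fun g hg => ?_⟩
  rw [blaschkeC_succ, mulC_mul_apply]
  exact hh.2 _ (blaschkeFactor_mem_multiplier (hΛ N) g hg)

/-- The unnormalised Takenaka–Malmquist functions. -/
def tmVec (Λ : ℕ → ℂ) (k : ℕ) : L2 := mulC (blaschkeC Λ k) (mulC (cauchyKer (Λ k)) (mono 0))

/-- The Takenaka–Malmquist orthonormal system. -/
def tmBasis (Λ : ℕ → ℂ) (k : ℕ) : L2 := (√(1 - ‖Λ k‖ ^ 2) : ℂ) • tmVec Λ k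

lemma cauchyKer_mono_mem_hardy {l : ℂ} (hl : ‖l‖ < 1) : mulC (cauchyKer l) (mono 0) ∈ hardy :=
  cauchyKer_mem_multiplier hl _ (mono_mem_hardy le_rfl)

lemma tmVec_mem_modelN_succ (hΛ : ∀ j, ‖Λ j‖ < 1) (k : ℕ) : tmVec Λ k ∈ modelN Λ (k + 1) := by
  rw [mem_modelN_iff hΛ]
  refine ⟨blaschkeC_mem_multiplier hΛ k _ (cauchyKer_mono_mem_hardy (hΛ k)), fun g hg => ?_⟩
  rw [blaschkeC_succ, mulC_mul_apply, tmVec, inner_mulC_mulC (norm_blaschkeC hΛ k)]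
  exact inner_blaschkeFactor_cauchyKer (hΛ k) hg

lemma tmBasis_mem_modelN (hΛ : ∀ j, ‖Λ j‖ < 1) {k N : ℕ} (h : k < N) :
    tmBasis Λ k ∈ modelN Λ N :=
  Submodule.smul_mem _ _ (modelN_mono hΛ h (tmVec_mem_modelN_succ hΛ k))

lemma one_sub_sq_pos {l : ℂ} (hl : ‖l‖ < 1) : 0 < 1 - ‖l‖ ^ 2 := by
  nlinarith [norm_nonneg l]

lemma norm_tmBasis (hΛ : ∀ j, ‖Λ j‖ < 1) (k : ℕ) : ‖tmBasis Λ k‖ = 1 := by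
  rw [← sq_eq_sq₀ (norm_nonneg _) zero_le_one, tmBasis, norm_smul, mul_pow, Complex.norm_real,
    Real.norm_eq_abs, sq_abs, Real.sq_sqrt (one_sub_sq_pos (hΛ k)).le, tmVec,
    norm_mulC_apply (norm_blaschkeC hΛ k), norm_sq_cauchyKer (hΛ k), one_pow]

/-- For `j < k` the function with index `j` lies in `K_{B_k}`, while that with index `k` lies in
`B_k H²`. -/
lemma inner_tmBasis_of_lt (hΛ : ∀ j, ‖Λ j‖ < 1) {j k : ℕ} (h : j < k) :
    inner ℂ (tmBasis Λ k) (tmBasis Λ j) = 0 := by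
  have h1 := ((mem_modelN_iff hΛ).1 (tmBasis_mem_modelN hΛ h)).2 _
    (cauchyKer_mono_mem_hardy (hΛ k))
  rw [tmBasis, inner_smul_left, tmVec, h1, mul_zero]

lemma orthonormal_tmBasis (hΛ : ∀ j, ‖Λ j‖ < 1) : Orthonormal ℂ (tmBasis Λ) := by
  refine ⟨norm_tmBasis hΛ, fun j k hjk => ?_⟩
  rcases lt_or_gt_of_ne hjk with h | h
  · rw [← inner_conj_symm, inner_tmBasis_of_lt hΛ h, map_zero]
  · exact inner_tmBasis_of_lt hΛ h

lemma modelN_le_span (hΛ : ∀ j, ‖Λ j‖ < 1) (N : ℕ) :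
    modelN Λ N ≤ Submodule.span ℂ (Set.range fun k : Fin N => tmBasis Λ k) := by
  induction N with
  | zero =>
    intro h hh
    rw [mem_modelN_iff hΛ] at hh
    have h1 := hh.2 h hh.1
    rw [blaschkeC, Finset.prod_range_zero, mulC_one] at h1
    exact (inner_self_eq_zero.1 h1 : h = 0) ▸ Submodule.zero_mem _
  | succ N ih =>
    intro h hh
    rw [mem_modelN_iff hΛ] at hh
    set B := blaschkeC Λ N
    have hB : ∀ t, ‖B t‖ = 1 := norm_blaschkeC hΛ N
    -- The part of `h` in `B_N H²` is `B_N g`. Since `h` is orthogonal to `B_{N+1} H²`, `g` is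
    -- orthogonal to the multiples of the last Blaschke factor and so is a Cauchy kernel up to
    -- scale.
    set g : L2 := hardy.starProjection (mulC (star B) h)
    have hg : g ∈ hardy := hardy.starProjection_apply_mem _
    have hgi (f : L2) (hf : f ∈ hardy) : inner ℂ f g = inner ℂ (mulC B f) h := by
      rw [inner_mulC_left, ← hardy.inner_starProjection_left_eq_right,
        Submodule.starProjection_eq_self_iff.2 hf]
    have h1 : h - mulC B g ∈ modelN Λ N := by
      rw [mem_modelN_iff hΛ]
      refine ⟨hardy.sub_mem hh.1 (blaschkeC_mem_multiplier hΛ N g hg), fun f hf => ?_⟩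
      rw [inner_sub_right, inner_mulC_mulC hB, hgi f hf, sub_self]
    obtain ⟨c, hc⟩ := exists_smul_cauchyKer (hΛ N) hg fun f hf => by
      rw [hgi _ (blaschkeFactor_mem_multiplier (hΛ N) f hf), ← mulC_mul_apply, ← blaschkeC_succ]
      exact hh.2 f hf
    have h2 : mulC B g = (c * (√(1 - ‖Λ N‖ ^ 2) : ℂ)⁻¹) • tmBasis Λ N := by
      have : (√(1 - ‖Λ N‖ ^ 2) : ℂ) ≠ 0 := by
        exact_mod_cast (Real.sqrt_pos.2 (one_sub_sq_pos (hΛ N))).ne'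
      rw [tmBasis, smul_smul, mul_assoc, inv_mul_cancel₀ this, mul_one, tmVec, ← map_smul, ← hc]
    rw [← sub_add_cancel h (mulC B g)]
    refine Submodule.add_mem _ (Submodule.span_mono ?_ (ih h1)) ?_
    · rintro _ ⟨k, rfl⟩
      exact ⟨k.castSucc, rfl⟩
    · rw [h2]
      exact Submodule.smul_mem _ _ (Submodule.subset_span ⟨Fin.last N, rfl⟩)

/-- The Takenaka–Malmquist basis of the model space. -/
def modelBasis (hΛ : ∀ j, ‖Λ j‖ < 1) (N : ℕ) : OrthonormalBasis (Fin N) ℂ (modelN Λ N) :=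
  OrthonormalBasis.mk (v := fun k : Fin N => ⟨tmBasis Λ k, tmBasis_mem_modelN hΛ k.2⟩)
    (by
      have h := (orthonormal_tmBasis hΛ).comp (fun k : Fin N => (k : ℕ)) Fin.val_injective
      exact ⟨fun k => h.1 k, fun j k hjk => h.2 hjk⟩)
    (by
      rintro x -
      have hx := modelN_le_span hΛ N x.2
      have h : Set.range (fun k : Fin N => tmBasis Λ k) = (modelN Λ N).subtype ''
          Set.range (fun k : Fin N =>
            (⟨tmBasis Λ k, tmBasis_mem_modelN hΛ k.2⟩ : modelN Λ N)) := by
        rw [← Set.range_comp]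
        rfl
      rw [h, ← Submodule.map_span] at hx
      obtain ⟨y, hy, hyx⟩ := hx
      exact (Subtype.ext hyx : y = x) ▸ hy)

lemma coe_modelBasis (hΛ : ∀ j, ‖Λ j‖ < 1) (N : ℕ) (k : Fin N) :
    (modelBasis hΛ N k : L2) = tmBasis Λ k :=
  congrArg Subtype.val (congrFun (OrthonormalBasis.coe_mk _ _) k)

end ModelSpace

/-! ### Almost invariance under continuous multipliers. -/

section OffDiagonal

variable {H : Type*} [NormedAddCommGroup H] [InnerProductSpace ℂ H]

lemma offDiag_eq_of_decomp (K : Submodule ℂ H) [K.HasOrthogonalProjection] {A : H →L[ℂ] H} {x : K}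
    {w : H} (h : A x - w ∈ K) (hw : w ∈ Kᗮ) : offDiag K A x = w := by
  rw [offDiag_apply, Submodule.eq_starProjection_of_mem_orthogonal' h hw (sub_add_cancel _ _).symm,
    sub_sub_cancel]

/-- Bessel's inequality for `a`, which need not lie in `K`. -/
lemma hsNorm_offDiag_le_of_rankOne {ι : Type*} [Fintype ι] (K : Submodule ℂ H)
    [K.HasOrthogonalProjection] (b : OrthonormalBasis ι ℂ K) {A : H →L[ℂ] H} (a w : H)
    (h : ∀ x : K, offDiag K A x = inner ℂ a (x : H) • w) :
    hsNorm b (offDiag K A) ≤ ‖a‖ * ‖w‖ := by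
  refine le_of_sq_le_sq ?_ (by positivity)
  have hb : Orthonormal ℂ fun i => (b i : H) := ⟨fun i => b.orthonormal.1 i,
    fun i j hij => b.orthonormal.2 hij⟩
  have h1 : ∑ i, ‖inner ℂ (b i : H) a‖ ^ 2 ≤ ‖a‖ ^ 2 := hb.sum_inner_products_le a
  simp only [hsNorm_sq, h, norm_smul, mul_pow, ← Finset.sum_mul]
  simp only [norm_inner_symm a]
  exact mul_le_mul_of_nonneg_right h1 (by positivity)

variable {Λ : ℕ → ℂ}

lemma mulC_comm_apply (F G : C(𝕋, ℂ)) (u : L2) : mulC F (mulC G u) = mulC G (mulC F u) := by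
  rw [← mulC_mul_apply, mul_comm, mulC_mul_apply]

/-- `ζ x` is orthogonal to `ζ B H²`, and `B H²` is the sum of that space and the line through `B`;
so only the component along `B` leaves the model space. -/
lemma offDiag_mulC_fourier_one (hΛ : ∀ j, ‖Λ j‖ < 1) (N : ℕ) (x : modelN Λ N) :
    offDiag (modelN Λ N) (mulC (fourier 1)) x =
      inner ℂ (mulC (fourier (-1)) (mulC (blaschkeC Λ N) (mono 0))) (x : L2) •
        mulC (blaschkeC Λ N) (mono 0) := by
  set B := blaschkeC Λ N
  have hB : ∀ t, ‖B t‖ = 1 := norm_blaschkeC hΛ N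
  obtain ⟨hx, hxB⟩ := (mem_modelN_iff hΛ).1 x.2
  have h0 : mono 0 ∈ hardy := mono_mem_hardy le_rfl
  have hin : inner ℂ (mulC (fourier (-1)) (mulC B (mono 0))) (x : L2) =
      inner ℂ (mulC B (mono 0)) (mulC (fourier 1) (x : L2)) := by
    rw [inner_mulC_left, star_fourier, neg_neg]
  rw [hin]
  refine offDiag_eq_of_decomp _ ?_ (Submodule.smul_mem _ _ ?_)
  · rw [mem_modelN_iff hΛ]
    refine ⟨hardy.sub_mem (fourier_one_mem_multiplier _ hx)
      (hardy.smul_mem _ (blaschkeC_mem_multiplier hΛ N _ h0)), fun g hg => ?_⟩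
    have hg' := backwardShift_mem_hardy hg
    have hdec : g = inner ℂ (mono 0) g • mono 0 + mulC (fourier 1)
        (mulC (fourier (-1)) g - inner ℂ (mono 0) g • mono (-1)) := by
      rw [map_sub, map_smul, mulC_fourier_mono, mulC_comm_apply, ← star_fourier 1,
        mulC_star_apply_mulC (norm_fourier_apply 1)]
      simp
    have h1 : inner ℂ (mulC B (mulC (fourier 1)
        (mulC (fourier (-1)) g - inner ℂ (mono 0) g • mono (-1))))
        (mulC (fourier 1) (x : L2)) = 0 := by
      rw [mulC_comm_apply, inner_mulC_mulC (norm_fourier_apply 1)]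
      exact hxB _ hg'
    have h2 : inner ℂ (mulC B g) (mulC (fourier 1) (x : L2)) =
        inner ℂ g (mono 0) * inner ℂ (mulC B (mono 0)) (mulC (fourier 1) (x : L2)) := by
      conv_lhs => rw [hdec]
      rw [map_add, inner_add_left, h1, add_zero, map_smul, inner_smul_left, inner_conj_symm]
    rw [inner_sub_right, inner_smul_right, inner_mulC_mulC hB, h2, mul_comm, sub_self]
  · rw [Submodule.mem_orthogonal']
    intro y hy
    exact ((mem_modelN_iff hΛ).1 hy).2 _ h0

/-- The model space is invariant under the backward shift, so only the constant term of `x` escapes,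
onto `ζ⁻¹`. -/
lemma offDiag_mulC_fourier_neg_one (hΛ : ∀ j, ‖Λ j‖ < 1) (N : ℕ) (x : modelN Λ N) :
    offDiag (modelN Λ N) (mulC (fourier (-1))) x = inner ℂ (mono 0) (x : L2) • mono (-1) := by
  obtain ⟨hx, hxB⟩ := (mem_modelN_iff hΛ).1 x.2
  refine offDiag_eq_of_decomp _ ?_ (Submodule.smul_mem _ _ ?_)
  · rw [mem_modelN_iff hΛ]
    refine ⟨backwardShift_mem_hardy hx, fun g hg => ?_⟩
    have h1 : inner ℂ (mulC (blaschkeC Λ N) g) (mono (-1)) = 0 := by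
      rw [← inner_conj_symm, mem_hardy_iff.1 (blaschkeC_mem_multiplier hΛ N g hg) _ (by norm_num),
        map_zero]
    rw [inner_sub_right, inner_smul_right, h1, mul_zero, sub_zero, ← star_fourier,
      ← inner_mulC_left, mulC_comm_apply]
    exact hxB _ (fourier_one_mem_multiplier _ hg)
  · rw [Submodule.mem_orthogonal']
    intro y hy
    exact mem_hardy_iff.1 ((mem_modelN_iff hΛ).1 hy).1 _ (by norm_num)

lemma mulC_fourier_mem_almostInvariant (hΛ : ∀ j, ‖Λ j‖ < 1) (n : ℤ) :
    mulC (fourier n) ∈ almostInvariant (modelBasis hΛ) := by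
  have h1 : mulC (fourier 1) ∈ almostInvariant (modelBasis hΛ) :=
    mem_almostInvariant_of_bounded 1 fun N => by
      refine (hsNorm_offDiag_le_of_rankOne _ _ _ _ (offDiag_mulC_fourier_one hΛ N)).trans_eq ?_
      simp only [norm_mulC_apply (norm_fourier_apply _), norm_mulC_apply (norm_blaschkeC hΛ N),
        norm_mono, mul_one]
  have h2 : mulC (fourier (-1)) ∈ almostInvariant (modelBasis hΛ) :=
    mem_almostInvariant_of_bounded 1 fun N => by
      refine (hsNorm_offDiag_le_of_rankOne _ _ _ _ (offDiag_mulC_fourier_neg_one hΛ N)).trans_eq ?_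
      simp only [norm_mono, mul_one]
  have hadd (a b : ℤ) : (fourier (a + b) : C(𝕋, ℂ)) = fourier a * fourier b := by
    ext t
    simp
  induction n with
  | zero =>
    have : (fourier 0 : C(𝕋, ℂ)) = 1 := by ext t; simp
    rw [this, mulC_one]
    exact Subalgebra.one_mem _
  | succ n ih =>
    rw [hadd, mulC_mul]
    exact Subalgebra.mul_mem _ ih h1
  | pred n ih =>
    rw [sub_eq_add_neg, hadd, mulC_mul]
    exact Subalgebra.mul_mem _ ih h2

lemma hsNorm_le_sqrt_mul_opNorm {ι E F : Type*} [Fintype ι] [NormedAddCommGroup E]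
    [InnerProductSpace ℂ E] [NormedAddCommGroup F] [InnerProductSpace ℂ F]
    (b : OrthonormalBasis ι ℂ E) (A : E →L[ℂ] F) : hsNorm b A ≤ ‖A‖ * √(Fintype.card ι) := by
  refine le_of_sq_le_sq ?_ (by positivity)
  rw [mul_pow, Real.sq_sqrt (by positivity), hsNorm_sq, mul_comm, ← nsmul_eq_mul, Fintype.card,
    ← Finset.sum_const]
  refine Finset.sum_le_sum fun i _ => pow_le_pow_left₀ (norm_nonneg _) ?_ 2
  simpa using A.le_opNorm (b i)

/-- Multiplication by a continuous function leaves the model spaces almost invariant. -/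
theorem mulC_mem_almostInvariant (hΛ : ∀ j, ‖Λ j‖ < 1) (F : C(𝕋, ℂ)) :
    mulC F ∈ almostInvariant (modelBasis hΛ) := by
  refine mem_almostInvariant_of_approx fun ε hε => ?_
  have hF : F ∈ (Submodule.span ℂ (Set.range <| @fourier 1)).topologicalClosure := by
    rw [span_fourier_closure_eq_top]; trivial
  -- The added 1 avoids any need to know that `‖mulC‖` is nonzero.
  have hε' : 0 < ε / (‖mulC‖ + 1) := by positivity
  obtain ⟨G, hG, hFG⟩ := Metric.mem_closure_iff.1 hF _ hε'
  refine ⟨mulC G, ?_, fun N _ => ?_⟩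
  · have hle : Submodule.span ℂ (Set.range <| @fourier 1) ≤
        (Subalgebra.toSubmodule (almostInvariant (modelBasis hΛ))).comap
          (mulC : C(𝕋, ℂ) →ₗ[ℂ] (L2 →L[ℂ] L2)) := by
      rw [Submodule.span_le]
      rintro _ ⟨n, rfl⟩
      exact mulC_fourier_mem_almostInvariant hΛ n
    exact hle hG
  · refine (hsNorm_le_sqrt_mul_opNorm _ _).trans ?_
    rw [Fintype.card_fin]
    gcongr
    refine (ContinuousLinearMap.opNorm_comp_le _ _).trans
      ((mul_le_of_le_one_right (norm_nonneg _) (Submodule.norm_subtypeL_le _)).trans ?_)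
    rw [← map_sub]
    refine (mulC.le_opNorm _).trans ?_
    rw [dist_eq_norm] at hFG
    have h1 : ‖mulC‖ * ‖F - G‖ ≤ (‖mulC‖ + 1) * (ε / (‖mulC‖ + 1)) := by gcongr; linarith
    rwa [mul_div_cancel₀ _ (by positivity)] at h1

end OffDiagonal

/-! ### The measures `ν_N` and the limit relation for polynomials. -/

section MeanHarmonicMeasure

variable {Λ : ℕ → ℂ}

/-- The density of `ν_N`. -/
def dens (Λ : ℕ → ℂ) (N : ℕ) (t : 𝕋) : ℝ :=
  (1 / (N : ℝ)) * ∑ j ∈ Finset.range N, (1 - ‖Λ j‖ ^ 2) / ‖pt t - Λ j‖ ^ 2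

lemma nu_eq (Λ : ℕ → ℂ) (N : ℕ) : nu Λ N = m.withDensity fun t => ENNReal.ofReal (dens Λ N t) :=
  rfl

lemma nu_absolutelyContinuous (Λ : ℕ → ℂ) (N : ℕ) : nu Λ N ≪ m :=
  withDensity_absolutelyContinuous _ _

lemma nu_zero (Λ : ℕ → ℂ) : nu Λ 0 = 0 := by
  simp [nu_eq, dens]

lemma continuous_pt : Continuous pt :=
  continuous_subtype_val.comp AddCircle.continuous_toCircle

lemma measurable_dens (Λ : ℕ → ℂ) (N : ℕ) : Measurable (dens Λ N) := by
  have := continuous_pt.measurable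
  unfold dens
  fun_prop

lemma dens_nonneg (hΛ : ∀ j, ‖Λ j‖ < 1) (N : ℕ) (t : 𝕋) : 0 ≤ dens Λ N t :=
  mul_nonneg (by positivity) (Finset.sum_nonneg fun j _ =>
    div_nonneg (one_sub_sq_pos (hΛ j)).le (by positivity))

lemma norm_sq_tmBasis_apply (hΛ : ∀ j, ‖Λ j‖ < 1) (k : ℕ) :
    ∀ᵐ t ∂m, ‖tmBasis Λ k t‖ ^ 2 = (1 - ‖Λ k‖ ^ 2) / ‖pt t - Λ k‖ ^ 2 := by
  filter_upwards [Lp.coeFn_smul (√(1 - ‖Λ k‖ ^ 2) : ℂ) (tmVec Λ k),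
    coeFn_mulC (blaschkeC Λ k) (mulC (cauchyKer (Λ k)) (mono 0)),
    coeFn_mulC (cauchyKer (Λ k)) (mono 0), coeFn_mono 0] with t h1 h2 h3 h4
  rw [tmBasis, h1, Pi.smul_apply, tmVec, h2, h3, h4, fourier_zero, mul_one, norm_smul, norm_mul,
    norm_blaschkeC hΛ, one_mul, cauchyKer_apply (hΛ k), norm_inv, norm_one_sub_conj_mul_pt, mul_pow,
    Complex.norm_real, Real.norm_eq_abs, sq_abs, Real.sq_sqrt (one_sub_sq_pos (hΛ k)).le, inv_pow,
    div_eq_mul_inv]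

/-- The reproducing kernel of the model space on the diagonal is a sum of Poisson kernels. This
identity ties the model spaces to `ν_N`. -/
lemma sum_norm_sq_tmBasis (hΛ : ∀ j, ‖Λ j‖ < 1) (N : ℕ) :
    ∀ᵐ t ∂m, ∑ k : Fin N, ‖tmBasis Λ k t‖ ^ 2 = N * dens Λ N t := by
  have h := ae_all_iff.2 fun k => norm_sq_tmBasis_apply hΛ k
  filter_upwards [h] with t ht
  rw [Finset.sum_congr rfl fun k _ => ht _, dens, Finset.sum_range]
  rcases Nat.eq_zero_or_pos N with rfl | hN
  · simp
  · field_simp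

lemma tr_compress_eq (hΛ : ∀ j, ‖Λ j‖ < 1) (N : ℕ) {A : L2 →L[ℂ] L2} {ψ : 𝕋 → ℂ}
    (hA : ∀ u : L2, A u =ᵐ[m] fun t => ψ t * u t) :
    tr (compress (modelN Λ N) A) = N * ∫ t, ψ t ∂(nu Λ N) := by
  have h1 (k : Fin N) : inner ℂ (modelBasis hΛ N k) (compress (modelN Λ N) A (modelBasis hΛ N k)) =
      inner ℂ (tmBasis Λ k) (A (tmBasis Λ k)) := by
    rw [compress, ContinuousLinearMap.comp_apply,
      Submodule.inner_orthogonalProjectionOnto_eq_of_mem_left]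
    simp [coe_modelBasis]
  rw [tr_eq_sum_inner (modelBasis hΛ N), Finset.sum_congr rfl fun k _ => h1 k]
  simp only [L2.inner_def]
  rw [← integral_finsetSum _ fun k _ => L2.integrable_inner _ _, nu_eq,
    integral_withDensity_eq_integral_toReal_smul (measurable_dens Λ N).ennreal_ofReal
      (by simp), ← integral_const_mul]
  refine integral_congr_ae ?_
  filter_upwards [sum_norm_sq_tmBasis hΛ N, ae_all_iff.2 fun k : ℕ => hA (tmBasis Λ k)] with t h2 h3
  have h4 (k : ℕ) : inner ℂ (tmBasis Λ k t) (A (tmBasis Λ k) t) =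
      ((‖tmBasis Λ k t‖ ^ 2 : ℝ) : ℂ) * ψ t := by
    rw [h3 k, RCLike.inner_apply, mul_assoc, Complex.mul_conj, Complex.normSq_eq_norm_sq, mul_comm]
  simp only [h4]
  rw [← Finset.sum_mul, ← Complex.ofReal_sum, h2, ENNReal.toReal_ofReal (dens_nonneg hΛ N t)]
  simp [mul_assoc]

/-- The trace formula for the identity operator, whose compression has trace `N`. -/
lemma isProbabilityMeasure_nu (hΛ : ∀ j, ‖Λ j‖ < 1) {N : ℕ} (hN : 1 ≤ N) :
    IsProbabilityMeasure (nu Λ N) := by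
  have h := tr_compress_eq hΛ N (A := 1) (ψ := fun _ => 1) fun u => by simp
  have h3 : tr (compress (modelN Λ N) 1) = N := by
    rw [compress_one, tr_eq_sum_inner (modelBasis hΛ N), Finset.sum_congr rfl fun k _ =>
      show inner ℂ (modelBasis hΛ N k) ((1 : modelN Λ N →L[ℂ] modelN Λ N) (modelBasis hΛ N k)) = 1
        from inner_self_eq_one_of_norm_eq_one ((modelBasis hΛ N).norm_eq_one k)]
    simp
  rw [h3, integral_const] at h
  have h0 : (N : ℂ) ≠ 0 := by exact_mod_cast (by omega : N ≠ 0)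
  have h1 : (nu Λ N).real Set.univ = 1 := by
    have h2 : (N : ℂ) * (((nu Λ N).real Set.univ : ℝ) : ℂ) = N * 1 := by simpa using h.symm
    exact_mod_cast mul_left_cancel₀ h0 h2
  exact ⟨(ENNReal.toReal_eq_one_iff _).1 h1⟩

instance isFiniteMeasure_nu_zero : IsFiniteMeasure (nu Λ 0) := by
  rw [nu_zero]; infer_instance

lemma isFiniteMeasure_nu (hΛ : ∀ j, ‖Λ j‖ < 1) (N : ℕ) : IsFiniteMeasure (nu Λ N) := by
  rcases Nat.eq_zero_or_pos N with rfl | hN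
  · infer_instance
  · have := isProbabilityMeasure_nu hΛ hN
    infer_instance

lemma eLpNorm_two_sq_eq_lintegral {α : Type*} [MeasurableSpace α] (μ : Measure α) (f : α → ℂ) :
    eLpNorm f 2 μ ^ 2 = ∫⁻ t, ‖f t‖ₑ ^ 2 ∂μ := by
  simpa using eLpNorm_nnreal_pow_eq_lintegral (f := f) (μ := μ) (p := 2) two_ne_zero

lemma enorm_sq_eq_lintegral (u : L2) : ‖u‖ₑ ^ 2 = ∫⁻ t, ‖u t‖ₑ ^ 2 ∂m := by
  rw [Lp.enorm_def, eLpNorm_two_sq_eq_lintegral]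

/-- Summing `|ψ e_k|²` under the integral gives an exact identity; the supremum over `N` in `‖·‖_Λ`
makes the resulting estimate uniform. -/
lemma enorm_hsNorm_mulOp (hΛ : ∀ j, ‖Λ j‖ < 1) (N : ℕ) (ψ : Linf) :
    ENNReal.ofReal (hsNorm (modelBasis hΛ N) (mulOp ψ ∘L (modelN Λ N).subtypeL) ^ 2) =
      N * eLpNorm ψ 2 (nu Λ N) ^ 2 := by
  have hψ : AEMeasurable (fun t => ‖ψ t‖ₑ ^ 2) m :=
    (Lp.aestronglyMeasurable ψ).enorm.pow_const 2
  have hR : eLpNorm ψ 2 (nu Λ N) ^ 2 =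
      ∫⁻ t, ENNReal.ofReal (dens Λ N t) * ‖ψ t‖ₑ ^ 2 ∂m := by
    rw [eLpNorm_two_sq_eq_lintegral, nu_eq, lintegral_withDensity_eq_lintegral_mul₀
      (measurable_dens Λ N).ennreal_ofReal.aemeasurable hψ]
    rfl
  rw [hsNorm_sq, ENNReal.ofReal_sum_of_nonneg fun k _ => by positivity, hR,
    ← lintegral_const_mul'' _ ((measurable_dens Λ N).ennreal_ofReal.aemeasurable.fun_mul hψ)]
  have h1 (k : Fin N) : ENNReal.ofReal
      (‖(mulOp ψ ∘L (modelN Λ N).subtypeL) (modelBasis hΛ N k)‖ ^ 2) =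
      ∫⁻ t, ‖mulOp ψ (tmBasis Λ k) t‖ₑ ^ 2 ∂m := by
    rw [← enorm_sq_eq_lintegral, ENNReal.ofReal_pow (norm_nonneg _), ofReal_norm]
    simp [coe_modelBasis]
  rw [Finset.sum_congr rfl fun k _ => h1 k, ← lintegral_finsetSum' _ fun (k : Fin N) _ =>
    (Lp.aestronglyMeasurable (mulOp ψ (tmBasis Λ k))).enorm.pow_const 2]
  refine lintegral_congr_ae ?_
  filter_upwards [sum_norm_sq_tmBasis hΛ N,
    ae_all_iff.2 fun k : ℕ => coeFn_mulOp ψ (tmBasis Λ k)] with t h2 h3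
  have h4 (k : ℕ) : ‖mulOp ψ (tmBasis Λ k) t‖ₑ ^ 2 =
      ENNReal.ofReal (‖tmBasis Λ k t‖ ^ 2) * ‖ψ t‖ₑ ^ 2 := by
    rw [h3 k, enorm_mul, mul_pow, ENNReal.ofReal_pow (norm_nonneg _), ofReal_norm, mul_comm]
  simp only [h4]
  rw [← Finset.sum_mul, ← ENNReal.ofReal_sum_of_nonneg fun k _ => by positivity, h2,
    ENNReal.ofReal_mul (by positivity), ENNReal.ofReal_natCast, mul_assoc]

/-- Multiplication by a bounded function of class `𝒳_Λ` leaves the model spaces almost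
invariant. -/
theorem mulOp_mem_almostInvariant (hΛ : ∀ j, ‖Λ j‖ < 1) {φ : Linf}
    (hφ : (φ : 𝕋 → ℂ) ∈ spaceX Λ) : mulOp φ ∈ almostInvariant (modelBasis hΛ) := by
  refine mem_almostInvariant_of_approx fun ε hε => ?_
  obtain ⟨g, hg⟩ := hφ.2 (ENNReal.ofReal ε) (by simpa using hε)
  refine ⟨mulC g, mulC_mem_almostInvariant hΛ g, fun N hN => ?_⟩
  set ψ : Linf := φ - ContinuousMap.toLp ∞ m ℂ g
  have hψ : mulOp φ - mulC g = mulOp ψ := by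
    rw [mulC_eq_mulOp]
    exact (map_sub ((ContinuousLinearMap.mul ℂ ℂ).holderL m ∞ 2 2) φ _).symm
  have hae : ψ =ᵐ[m] fun t => φ t - g t := by
    filter_upwards [Lp.coeFn_sub φ (ContinuousMap.toLp ∞ m ℂ g),
      ContinuousMap.coeFn_toLp (p := ∞) (𝕜 := ℂ) m g] with t h1 h2
    rw [h1, Pi.sub_apply, h2]
  have h1 : eLpNorm ψ 2 (nu Λ N) ≤ ENNReal.ofReal ε := by
    rw [eLpNorm_congr_ae ((nu_absolutelyContinuous Λ N).ae_eq hae)]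
    refine le_trans ?_ hg.le
    exact le_iSup₂ (f := fun N (_ : 1 ≤ N) => eLpNorm (fun t => φ t - g t) 2 (nu Λ N)) N hN
  refine le_of_sq_le_sq ?_ (by positivity)
  rw [hψ, mul_pow, Real.sq_sqrt (by positivity), ← ENNReal.ofReal_le_ofReal_iff (by positivity),
    enorm_hsNorm_mulOp hΛ, ENNReal.ofReal_mul (by positivity), ENNReal.ofReal_natCast, mul_comm,
    ENNReal.ofReal_pow hε.le]
  gcongr

lemma coeFn_aeval_mulOp (φ : Linf) (p : Polynomial ℂ) (u : L2) :
    Polynomial.aeval (mulOp φ) p u =ᵐ[m] fun t => p.eval (φ t) * u t := by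
  induction p using Polynomial.induction_on generalizing u with
  | C a =>
    rw [Polynomial.aeval_C, Algebra.algebraMap_eq_smul_one]
    filter_upwards [Lp.coeFn_smul a u] with t h
    simpa using h
  | add p q hp hq =>
    rw [map_add]
    filter_upwards [Lp.coeFn_add (Polynomial.aeval (mulOp φ) p u) (Polynomial.aeval (mulOp φ) q u),
      hp u, hq u] with t h1 h2 h3
    rw [add_apply, h1, Pi.add_apply, h2, h3, Polynomial.eval_add, add_mul]
  | monomial n a ih =>
    have h : (.C a * .X ^ (n + 1) : Polynomial ℂ) = (.C a * .X ^ n) * .X := by ring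
    rw [h, map_mul (Polynomial.aeval (mulOp φ)) (Polynomial.C a * Polynomial.X ^ n) Polynomial.X,
      Polynomial.aeval_X]
    filter_upwards [ih (mulOp φ u), coeFn_mulOp φ u] with t h1 h2
    rw [mul_apply_eq_comp, h1, h2, Polynomial.eval_mul_X, mul_assoc]

/-- The Szegő limit relation for polynomials. -/
theorem tendsto_tr_aeval_toeplitzN (hΛ : ∀ j, ‖Λ j‖ < 1) {φ : Linf}
    (hφ : (φ : 𝕋 → ℂ) ∈ spaceX Λ) (p : Polynomial ℂ) :
    Tendsto (fun N : ℕ => ‖(1 / (N : ℂ)) * tr (Polynomial.aeval (toeplitzN Λ N φ) p) -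
      ∫ t, p.eval (φ t) ∂(nu Λ N)‖) atTop (𝓝 0) := by
  refine (tendsto_tr_compress_aeval_sub (mulOp_mem_almostInvariant hΛ hφ) p).congr' ?_
  filter_upwards [eventually_ge_atTop 1] with N hN
  have h0 : (N : ℂ) ≠ 0 := by exact_mod_cast (by omega : N ≠ 0)
  rw [tr_compress_eq hΛ N (coeFn_aeval_mulOp φ p), ← mul_assoc, one_div_mul_cancel h0, one_mul]
  rfl

end MeanHarmonicMeasure

/-! ### The essential range and its closed convex hull. -/

section EssentialRange

lemma ae_norm_le (φ : Linf) : ∀ᵐ t ∂m, ‖φ t‖ ≤ ‖φ‖ := by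
  filter_upwards [ae_le_eLpNormEssSup (f := φ) (μ := m)] with t ht
  rw [← eLpNorm_exponent_top, ← Lp.enorm_def] at ht
  simpa [enorm_le_iff_norm_le] using ht

/-- The essential range contains the support of the pushforward of `m` under `φ`, which has full
measure. -/
lemma ae_mem_essRange (φ : Linf) : ∀ᵐ t ∂m, φ t ∈ essRange φ := by
  have hφ : AEMeasurable φ m := (Lp.aestronglyMeasurable φ).aemeasurable
  filter_upwards [ae_of_ae_map hφ (Measure.support_mem_ae (μ := m.map φ))] with t ht ε hε
  have h := (Measure.mem_support_iff_forall _).1 ht _ (Metric.ball_mem_nhds _ hε)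
  rw [Measure.map_apply_of_aemeasurable hφ Metric.isOpen_ball.measurableSet] at h
  simpa [Set.preimage, Metric.mem_ball, dist_eq_norm] using h

lemma essRange_subset_closedBall (φ : Linf) : essRange φ ⊆ Metric.closedBall 0 ‖φ‖ := by
  intro w hw
  rw [mem_closedBall_zero_iff]
  refine le_of_forall_pos_le_add fun ε hε => ?_
  have h := hw ε hε
  obtain ⟨t, h1, h2⟩ := ((frequently_ae_iff.2 h.ne').and_eventually (ae_norm_le φ)).exists
  have h3 := norm_sub_norm_le w (φ t)
  rw [norm_sub_rev] at h3
  linarith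

lemma isCompact_closedConvexHull_essRange (φ : Linf) :
    IsCompact (closedConvexHull ℝ (essRange φ)) :=
  (isCompact_closedBall 0 ‖φ‖).of_isClosed_subset isClosed_closedConvexHull
    (closedConvexHull_min (essRange_subset_closedBall φ) (convex_closedBall _ _)
      Metric.isClosed_closedBall)

end EssentialRange

/-! ### Location of the spectrum. -/

section Spectrum

variable {Λ : ℕ → ℂ}

/-- The spectrum of an operator on a finite-dimensional space lies in its numerical range. -/
lemma exists_inner_eq_of_mem_spectrum {E : Type*} [NormedAddCommGroup E] [InnerProductSpace ℂ E]
    [FiniteDimensional ℂ E] {T : E →L[ℂ] E} {z : ℂ} (hz : z ∈ spectrum ℂ T) :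
    ∃ u : E, ‖u‖ = 1 ∧ inner ℂ u (T u) = z := by
  rw [spectrum_eq_spectrum_toLinearMap, ← Module.End.hasEigenvalue_iff_mem_spectrum] at hz
  obtain ⟨v, hv⟩ := hz.exists_hasEigenvector
  have hu : ‖(‖v‖⁻¹ : ℂ) • v‖ = 1 := by
    simp only [norm_smul, norm_inv, Complex.norm_real, norm_norm]
    exact inv_mul_cancel₀ (norm_ne_zero_iff.2 hv.2)
  refine ⟨(‖v‖⁻¹ : ℂ) • v, hu, ?_⟩
  have h : T v = z • v := hv.apply_eq_smul
  rw [map_smul, h, smul_comm, inner_smul_right, inner_self_eq_one_of_norm_eq_one hu, mul_one]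

lemma norm_tr_contFC_sub_le {ι E : Type*} [Fintype ι] [NormedAddCommGroup E]
    [InnerProductSpace ℂ E] [CompleteSpace E] (b : OrthonormalBasis ι ℂ E) {T : E →L[ℂ] E}
    (hT : IsStarNormal T) {f : ℝ → ℂ} (hf : ContinuousOn (fun z : ℂ => f z.re) (spectrum ℂ T))
    (p : Polynomial ℂ) {ε : ℝ} (hε : 0 ≤ ε)
    (hp : ∀ z ∈ spectrum ℂ T, ‖f z.re - p.eval z‖ ≤ ε) :
    ‖tr (contFC f T) - tr (Polynomial.aeval T p)‖ ≤ Fintype.card ι * ε := by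
  have h1 : contFC f T - Polynomial.aeval T p =
      cfc (p := IsStarNormal) (fun z : ℂ => f z.re - p.eval z) T := by
    rw [cfc_sub _ _ _ hf p.continuous.continuousOn, ← cfc_polynomial p _ hT]
    rfl
  have h2 : tr (contFC f T) - tr (Polynomial.aeval T p) =
      tr (contFC f T - Polynomial.aeval T p) := by
    simp [tr]
  rw [h2, h1]
  exact (norm_tr_le_opNorm b _).trans (by gcongr; exact norm_cfc_le hε hp)

/-- The inner product is the average of `φ` against the probability measure `|u|² dm`. -/
lemma inner_mulOp_mem {φ : Linf} {S : Set ℂ} (hS : Convex ℝ S) (hSc : IsClosed S)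
    (hφ : ∀ᵐ t ∂m, φ t ∈ S) {u : L2} (hu : ‖u‖ = 1) : inner ℂ u (mulOp φ u) ∈ S := by
  let ρ : Measure 𝕋 := m.withDensity fun t => ‖u t‖ₑ ^ 2
  have hum : AEMeasurable (fun t => ‖u t‖ₑ ^ 2) m :=
    (Lp.aestronglyMeasurable u).enorm.pow_const 2
  have hac : ρ ≪ m := withDensity_absolutelyContinuous _ _
  have hρ : IsProbabilityMeasure ρ := by
    refine ⟨?_⟩
    rw [withDensity_apply _ MeasurableSet.univ, setLIntegral_univ, ← enorm_sq_eq_lintegral,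
      ← ofReal_norm, hu]
    simp
  have hint : Integrable φ ρ :=
    Integrable.of_bound ((Lp.aestronglyMeasurable φ).mono_ac hac) ‖φ‖ (hac.ae_le (ae_norm_le φ))
  have h := hS.integral_mem hSc (hac.ae_le hφ) hint
  convert h using 1
  rw [integral_withDensity_eq_integral_toReal_smul₀ hum (by simp), L2.inner_def]
  refine integral_congr_ae ?_
  filter_upwards [coeFn_mulOp φ u] with t ht
  rw [ht, RCLike.inner_apply, mul_assoc, Complex.mul_conj, Complex.normSq_eq_norm_sq, mul_comm]
  simp

lemma finiteDimensional_modelN (hΛ : ∀ j, ‖Λ j‖ < 1) (N : ℕ) :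
    FiniteDimensional ℂ (modelN Λ N) :=
  (modelBasis hΛ N).toBasis.finiteDimensional_of_finite

lemma finrank_modelN (hΛ : ∀ j, ‖Λ j‖ < 1) (N : ℕ) : Module.finrank ℂ (modelN Λ N) = N := by
  rw [Module.finrank_eq_card_basis (modelBasis hΛ N).toBasis, Fintype.card_fin]

lemma spectrum_toeplitzN_subset (hΛ : ∀ j, ‖Λ j‖ < 1) {φ : Linf} {S : Set ℂ} (hS : Convex ℝ S)
    (hSc : IsClosed S) (hφ : ∀ᵐ t ∂m, φ t ∈ S) (N : ℕ) : spectrum ℂ (toeplitzN Λ N φ) ⊆ S := by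
  intro z hz
  have := finiteDimensional_modelN hΛ N
  obtain ⟨u, hu, h1⟩ := exists_inner_eq_of_mem_spectrum hz
  have h2 : inner ℂ u (toeplitzN Λ N φ u) = inner ℂ (u : L2) (mulOp φ u) :=
    Submodule.inner_orthogonalProjectionOnto_eq_of_mem_left u (mulOp φ u)
  exact (h2.symm.trans h1) ▸ inner_mulOp_mem hS hSc hφ (u := (u : L2)) hu

lemma isSelfAdjoint_toeplitzN {φ : Linf} (hφ : ∀ᵐ t ∂m, (φ t).im = 0) (N : ℕ) :
    IsSelfAdjoint (toeplitzN Λ N φ) := by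
  rw [ContinuousLinearMap.isSelfAdjoint_iff_isSymmetric]
  intro x y
  have h1 : inner ℂ x (toeplitzN Λ N φ y) = inner ℂ (x : L2) (mulOp φ y) :=
    Submodule.inner_orthogonalProjectionOnto_eq_of_mem_left x (mulOp φ y)
  have h2 : inner ℂ (toeplitzN Λ N φ x) y = inner ℂ (mulOp φ x) (y : L2) :=
    Submodule.inner_orthogonalProjectionOnto_eq_of_mem_right y (mulOp φ x)
  refine h2.trans (Eq.trans ?_ h1.symm)
  rw [L2.inner_def, L2.inner_def]
  refine integral_congr_ae ?_
  filter_upwards [hφ, coeFn_mulOp φ x, coeFn_mulOp φ y] with t h3 h4 h5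
  rw [h4, h5, RCLike.inner_apply, RCLike.inner_apply, map_mul, Complex.conj_eq_iff_im.2 h3]
  ring

end Spectrum

/-! ### Passage from polynomials to general functions. -/

section Limit

variable {Λ : ℕ → ℂ}

/-- The passage from polynomials to uniform limits of polynomials in the Szegő limit relation. -/
lemma szego_of_approx (hΛ : ∀ j, ‖Λ j‖ < 1) {φ : Linf} (hφ : (φ : 𝕋 → ℂ) ∈ spaceX Λ) {S : Set ℂ}
    (hS : IsCompact S) (hφS : ∀ᵐ t ∂m, φ t ∈ S) {F : ℂ → ℂ} (hF : ContinuousOn F S)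
    (happrox : ∀ ε : ℝ, 0 < ε → ∃ p : Polynomial ℂ, ∀ z ∈ S, ‖F z - p.eval z‖ < ε)
    {τ : ℕ → ℂ} (hτ : ∀ (N : ℕ) (p : Polynomial ℂ) (ε : ℝ), 0 ≤ ε →
      (∀ z ∈ S, ‖F z - p.eval z‖ ≤ ε) →
        ‖τ N - tr (Polynomial.aeval (toeplitzN Λ N φ) p)‖ ≤ N * ε) :
    (∀ N : ℕ, Integrable (fun t => F (φ t)) (nu Λ N)) ∧
      Tendsto (fun N : ℕ => ‖(1 / (N : ℂ)) * τ N - ∫ t, F (φ t) ∂(nu Λ N)‖) atTop (𝓝 0) := by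
  classical
  have hint {G : ℂ → ℂ} (hG : ContinuousOn G S) (N : ℕ) :
      Integrable (fun t => G (φ t)) (nu Λ N) := by
    have := isFiniteMeasure_nu hΛ N
    -- Nothing is assumed about `G` off `S`; extending by zero gives a measurable function that
    -- agrees with it at almost every value of `φ`.
    have hmeas : Measurable (S.piecewise G 0) :=
      hG.measurable_piecewise continuous_zero.continuousOn hS.isClosed.measurableSet
    have h1 : AEStronglyMeasurable (fun t => G (φ t)) m := by
      refine (hmeas.comp_aemeasurable
        (Lp.aestronglyMeasurable φ).aemeasurable).aestronglyMeasurable.congr ?_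
      filter_upwards [hφS] with t ht
      simp [ht]
    obtain ⟨C, hC⟩ := hS.exists_bound_of_continuousOn hG
    refine Integrable.of_bound (h1.mono_ac (nu_absolutelyContinuous Λ N)) C ?_
    filter_upwards [(nu_absolutelyContinuous Λ N).ae_le hφS] with t ht using hC _ ht
  refine ⟨hint hF, ?_⟩
  rw [Metric.tendsto_atTop]
  intro ε hε
  obtain ⟨p, hp⟩ := happrox (ε / 3) (by positivity)
  obtain ⟨n, hn⟩ := Metric.tendsto_atTop.1 (tendsto_tr_aeval_toeplitzN hΛ hφ p) (ε / 3)
    (by positivity)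
  refine ⟨max n 1, fun N hN => ?_⟩
  have hN1 : 1 ≤ N := (le_max_right _ _).trans hN
  have h1 := hn N ((le_max_left _ _).trans hN)
  rw [dist_zero_right, norm_norm] at h1 ⊢
  have := isProbabilityMeasure_nu hΛ hN1
  have h2 : ‖(1 / (N : ℂ)) * (τ N - tr (Polynomial.aeval (toeplitzN Λ N φ) p))‖ ≤ ε / 3 := by
    have h0 : (0 : ℝ) < N := by exact_mod_cast hN1
    rw [norm_mul, norm_div, norm_one, Complex.norm_natCast, one_div, inv_mul_le_iff₀ h0]
    exact hτ N p (ε / 3) (by positivity) fun z hz => (hp z hz).le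
  have h3 : ‖∫ t, (p.eval (φ t) - F (φ t)) ∂(nu Λ N)‖ ≤ ε / 3 := by
    have h4 : ∀ᵐ t ∂(nu Λ N), ‖p.eval (φ t) - F (φ t)‖ ≤ ε / 3 := by
      filter_upwards [(nu_absolutelyContinuous Λ N).ae_le hφS] with t ht
      rw [norm_sub_rev]
      exact (hp _ ht).le
    simpa using norm_integral_le_of_norm_le_const h4
  rw [integral_sub (hint (G := fun z => p.eval z) p.continuous.continuousOn N) (hint hF N)] at h3
  have h5 : (1 / (N : ℂ)) * τ N - ∫ t, F (φ t) ∂(nu Λ N) =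
      (1 / (N : ℂ)) * (τ N - tr (Polynomial.aeval (toeplitzN Λ N φ) p)) +
      ((1 / (N : ℂ)) * tr (Polynomial.aeval (toeplitzN Λ N φ) p) -
        ∫ t, p.eval (φ t) ∂(nu Λ N)) +
      ((∫ t, p.eval (φ t) ∂(nu Λ N)) - ∫ t, F (φ t) ∂(nu Λ N)) := by ring
  rw [h5]
  refine (norm_add₃_le).trans_lt ?_
  linarith

/-- The Szegő limit relation for the holomorphic functional calculus. -/
theorem szego_holFC (hΛ : ∀ j, ‖Λ j‖ < 1) {φ : Linf} (hφ : (φ : 𝕋 → ℂ) ∈ spaceX Λ)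
    {f : ℂ → ℂ} {U : Set ℂ} (hU : IsOpen U) (hKU : closedConvexHull ℝ (essRange φ) ⊆ U)
    (hf : DifferentiableOn ℂ f U) :
    (∀ N : ℕ, Integrable (fun t => f (φ t)) (nu Λ N)) ∧
      Tendsto (fun N : ℕ => ‖(1 / (N : ℂ)) * tr (holFC f (toeplitzN Λ N φ)) -
        ∫ t, f (φ t) ∂(nu Λ N)‖) atTop (𝓝 0) := by
  have hφK : ∀ᵐ t ∂m, φ t ∈ closedConvexHull ℝ (essRange φ) :=
    (ae_mem_essRange φ).mono fun t ht => subset_closedConvexHull ht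
  have hKc := isCompact_closedConvexHull_essRange φ
  refine szego_of_approx hΛ hφ hKc hφK (hf.continuousOn.mono hKU)
    (fun ε hε => exists_polynomial_near_of_differentiableOn hKc convex_closedConvexHull hU hKU hf
      hε) fun N p ε _ hp => ?_
  have := finiteDimensional_modelN hΛ N
  have hspec := spectrum_toeplitzN_subset hΛ convex_closedConvexHull isClosed_closedConvexHull hφK N
  -- Both traces become sums over the same eigenvalues with the same multiplicities, so a uniform
  -- bound `ε` on the hull costs at most `N ε`, without normality.
  rw [tr_holFC _ hU hf (hspec.trans hKU), tr_aeval_eq_sum, ← Finset.sum_sub_distrib]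
  have hsum := sum_algMult (toeplitzN Λ N φ)
  rw [finrank_modelN hΛ N] at hsum
  refine (norm_sum_le _ _).trans ?_
  conv_rhs => rw [← hsum]
  rw [Nat.cast_sum, Finset.sum_mul]
  refine Finset.sum_le_sum fun μ hμ => ?_
  rw [← sub_mul, norm_mul, Complex.norm_natCast, mul_comm]
  exact mul_le_mul_of_nonneg_left (hp μ (hspec (by simpa using hμ))) (by positivity)

/-- The Szegő limit relation for the continuous functional calculus. -/
theorem szego_contFC (hΛ : ∀ j, ‖Λ j‖ < 1) {φ : Linf} (hφ : (φ : 𝕋 → ℂ) ∈ spaceX Λ)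
    (hreal : ∀ᵐ t ∂m, (φ t).im = 0) {f : ℝ → ℂ}
    (hf : ContinuousOn f (Set.Icc (essInf (fun t => (φ t).re) m) (essSup (fun t => (φ t).re) m))) :
    (∀ N : ℕ, Integrable (fun t => f (φ t).re) (nu Λ N)) ∧
      Tendsto (fun N : ℕ => ‖(1 / (N : ℂ)) * tr (contFC f (toeplitzN Λ N φ)) -
        ∫ t, f (φ t).re ∂(nu Λ N)‖) atTop (𝓝 0) := by
  set a := essInf (fun t => (φ t).re) m
  set b := essSup (fun t => (φ t).re) m
  -- For real `φ` this embedded segment is closed and convex in `ℂ`, so it confines the spectrum as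
  -- before, and Weierstrass approximation replaces Runge's theorem.
  let S : Set ℂ := (fun x : ℝ => (x : ℂ)) '' Set.Icc a b
  have hScomp : IsCompact S := isCompact_Icc.image Complex.continuous_ofReal
  have hSconv : Convex ℝ S := (convex_Icc a b).linear_image Complex.ofRealCLM.toLinearMap
  have hbd : ∀ᵐ t ∂m, |(φ t).re| ≤ ‖φ‖ :=
    (ae_norm_le φ).mono fun t ht => (Complex.abs_re_le_norm _).trans ht
  have hφS : ∀ᵐ t ∂m, φ t ∈ S := by
    have h1 : ∀ᵐ t ∂m, a ≤ (φ t).re :=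
      ae_essInf_le ⟨-‖φ‖, eventually_map.2 (hbd.mono fun t ht => (abs_le.1 ht).1)⟩
    have h2 : ∀ᵐ t ∂m, (φ t).re ≤ b :=
      ae_le_essSup ⟨‖φ‖, eventually_map.2 (hbd.mono fun t ht => (abs_le.1 ht).2)⟩
    filter_upwards [h1, h2, hreal] with t h1 h2 h3
    exact ⟨(φ t).re, ⟨h1, h2⟩, Complex.ext (by simp) (by simp [h3])⟩
  have hF : ContinuousOn (fun z : ℂ => f z.re) S := by
    refine hf.comp Complex.continuous_re.continuousOn ?_
    rintro _ ⟨x, hx, rfl⟩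
    simpa using hx
  refine szego_of_approx hΛ hφ hScomp hφS (F := fun z => f z.re) hF (fun ε hε => ?_)
    fun N p ε hε hp => ?_
  · obtain ⟨p, hp⟩ := exists_polynomial_near_of_continuousOn_Icc hf hε
    refine ⟨p, ?_⟩
    rintro _ ⟨x, hx, rfl⟩
    simpa using hp x hx
  · have hspec := spectrum_toeplitzN_subset hΛ hSconv hScomp.isClosed hφS N
    have hnormal : IsStarNormal (toeplitzN Λ N φ) := (isSelfAdjoint_toeplitzN hreal N).isStarNormal
    have h := norm_tr_contFC_sub_le (modelBasis hΛ N) hnormal (hF.mono hspec) p hε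
      fun z hz => hp z (hspec hz)
    rwa [Fintype.card_fin] at h

end Limit

end SzegoTTO

end

theorem theorem1 (Λ : ℕ → ℂ) (hΛ : ∀ j, ‖Λ j‖ < 1)
    (φ : SzegoTTO.Linf) (hφ : (φ : SzegoTTO.𝕋 → ℂ) ∈ SzegoTTO.spaceX Λ) :
    (∀ (f : ℂ → ℂ) (U : Set ℂ), IsOpen U → closedConvexHull ℝ (SzegoTTO.essRange φ) ⊆ U →
      DifferentiableOn ℂ f U →
      (∀ N : ℕ, Integrable (fun t => f (φ t)) (SzegoTTO.nu Λ N)) ∧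
      Tendsto (fun N : ℕ =>
        ‖(1 / (N : ℂ)) * SzegoTTO.tr (SzegoTTO.holFC f (SzegoTTO.toeplitzN Λ N φ))
          - ∫ t, f (φ t) ∂(SzegoTTO.nu Λ N)‖) atTop (𝓝 0)) ∧
    ((∀ᵐ t ∂SzegoTTO.m, (φ t).im = 0) →
      ∀ f : ℝ → ℂ,
        ContinuousOn f (Set.Icc (essInf (fun t => (φ t).re) SzegoTTO.m)
          (essSup (fun t => (φ t).re) SzegoTTO.m)) →
        (∀ N : ℕ, Integrable (fun t => f (φ t).re) (SzegoTTO.nu Λ N)) ∧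
        Tendsto (fun N : ℕ =>
          ‖(1 / (N : ℂ)) * SzegoTTO.tr (SzegoTTO.contFC f (SzegoTTO.toeplitzN Λ N φ))
            - ∫ t, f (φ t).re ∂(SzegoTTO.nu Λ N)‖) atTop (𝓝 0)) := by
  exact ⟨fun _ _ hU hKU hf => SzegoTTO.szego_holFC hΛ hφ hU hKU hf,
    fun hreal _ hf => SzegoTTO.szego_contFC hΛ hφ hreal hf⟩
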